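/- Let $d\ge 1$ and let $F_0,G_0\in C^2([0,\infty))$ be such that the radially symmetric vector fields $V_0(x)=F_0(|x|)\,x$ and $E_0(x)=G_0(|x|)\,x$ on $\mathbb R^d$ are bounded together with their first derivatives, and such that the initial density $n_0(x)=1-\operatorname{div}E_0(x)$ is positive for every $x\in\mathbb R^d$. Then there is a friction coefficient $\nu>2$ for which the Cauchy problem $$\partial_t V+(V\cdot\nabla)V=-E-\nu V,\qquad \partial_t E+V\operatorname{div}E=V,\qquad V|_{t=0}=V_0,\quad E|_{t=0}=E_0,$$ has a radially symmetric solution $V(t,x)=F(t,|x|)\,x$, $E(t,x)=G(t,|x|)\,x$ that is $C^1$ on $[0,\infty)\times\mathbb R^d$, and every radially symmetric $C^1$ solution of the problem on a time interval $[0,T)$ coincides with it there. If moreover $\inf_{x}n_0(x)>0$, then for the same $\nu$ there is a constant $C>0$ such that for all $t\ge 0$ $$\|V(t,\cdot)\|_{C^1}+\|E(t,\cdot)\|_{C^1}\le C\,e^{-\frac{\nu-\sqrt{\nu^2-4}}{2}\,t},$$ so that these norms tend to $0$ as $t\to\infty$. Here $\|W\|_{C^1}=\sup_{x\in\mathbb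 R^d}|W(x)|+\sup_{x\in\mathbb R^d}|\nabla W(x)|$. -/

import Mathlib

open Set Filter Topology
open scoped ENNReal

namespace ColdPlasma

/-- The physical space `ℝ^d` with its Euclidean norm. -/
abbrev Space (d : ℕ) : Type := EuclideanSpace ℝ (Fin d)

/-- The radially symmetric vector field `x ↦ f(|x|) x` on `ℝ^d`. -/
noncomputable def radialField (d : ℕ) (f : ℝ → ℝ) (x : Space d) : Space d := f ‖x‖ • x

/-- The divergence `∑ i, ∂ W_i / ∂ x_i` of a vector field `W` at the point `x`. -/
noncomputable def divergence {d : ℕ} (W : Space d → Space d) (x : Space d) : ℝ :=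
  ∑ i : Fin d, (fderiv ℝ W x (EuclideanSpace.single i 1)) i

/-- The `C^1` norm `sup |W| + sup |∇ W|`, with values in `[0, ∞]`. -/
noncomputable def c1Norm {d : ℕ} (W : Space d → Space d) : ℝ≥0∞ :=
  (⨆ x, ‖W x‖ₑ) + ⨆ x, ‖fderiv ℝ W x‖ₑ

/-- `(V, E)` is a radially symmetric solution, of class `C^1` jointly in time and space on
`I × ℝ^d`, of the Cauchy problem
`∂V/∂t + (V · ∇) V = - E - ν V`, `∂E/∂t + V div E = V`,
`V(0, x) = F₀(|x|) x`, `E(0, x) = G₀(|x|) x`.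
Here `I` is a time interval that contains its left end point `0`; at `t = 0` the time derivative is
one-sided. -/
structure IsRadialSolution (d : ℕ) (ν : ℝ) (F₀ G₀ : ℝ → ℝ) (I : Set ℝ)
    (V E : ℝ → Space d → Space d) : Prop where
  contDiffOn_V : ContDiffOn ℝ 1 (fun p : ℝ × Space d => V p.1 p.2) (I ×ˢ univ)
  contDiffOn_E : ContDiffOn ℝ 1 (fun p : ℝ × Space d => E p.1 p.2) (I ×ˢ univ)
  radial_V : ∃ F : ℝ → ℝ → ℝ, ∀ t ∈ I, V t = radialField d (F t)
  radial_E : ∃ G : ℝ → ℝ → ℝ, ∀ t ∈ I, E t = radialField d (G t)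
  momentum : ∀ t ∈ I, ∀ x, HasDerivWithinAt (fun s => V s x)
    (-(fderiv ℝ (V t) x (V t x)) - E t x - ν • V t x) I t
  field : ∀ t ∈ I, ∀ x, HasDerivWithinAt (fun s => E s x)
    (V t x - divergence (E t) x • V t x) I t
  initial_V : V 0 = radialField d F₀
  initial_E : E 0 = radialField d G₀

end ColdPlasma

namespace ColdPlasma

open scoped NNReal
open Metric

/-! ### Global flows of bounded Lipschitz fields -/

section Flow

variable {E : Type*} [NormedAddCommGroup E] [NormedSpace ℝ E]

/-! For radial fields the system is a family of ordinary differential equations. Along `r' = F r`,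
started at radius `ρ`, one has `r = ρ exp l` and `F' = -F² - νF - G`, `G' = F (1 - d G)`, `l' = F`.
With the mean density `N = 1 - d G` the second equation reads `N' = -d F N`, so `N exp (d l)` is
conserved and `N` stays positive.

Large friction makes this system overdamped. Barriers keep `F` and `N` in a fixed box
(`characteristic_bounds`), so a cut-off system with a bounded Lipschitz field has the same
trajectories, and they are `C^1` in `(t, ρ)` (`exists_contDiff_family`). Characteristics of
different radii do not cross as long as `x = 1 + ρ lρ` is positive. Differentiating the conserved
quantity in `ρ` gives `ρ Gρ = N (x - κ)`, where `κ = n₀ / N₀` is formed from the initial density and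
mean density. Hence `x'' + (ν + 2F) x' + N x = N κ`, an overdamped oscillator pushed by a positive
force because `n₀ > 0` (`jacobian_pos`). The radial flow is therefore invertible, and the inverse
function theorem turns the family into a `C^1` solution on space-time (`IsCharFamily.transported`,
`IsCharFamily.isRadialSolution`). For another radial solution, the differences from `F x` and `G x`
along the constructed characteristics solve a linear homogeneous system with zero data, which gives
uniqueness.

Decay takes two steps. A Lyapunov function yields some exponential rate, uniform in `ρ`, when `n₀`
is bounded below (`exists_exp_decay`). Then `(F, G)`, `(rF, rG)` and `(ρ Fρ, ρ Gρ)` all solve `p' =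
-νp - s`, `s' = p` up to terms with exponentially decaying coefficients. Such terms change the
constant only, so the slow root of `λ² - νλ + 1` is the rate (`exists_decay_of_perturbation`). A
uniform lower bound for `x` converts this to the `C^1` norm. -/

theorem norm_le_gronwallBound_abs {y y' : ℝ → E} {δ K ε T : ℝ}
    (hy : ∀ t, HasDerivAt y (y' t) t) (h0 : ‖y 0‖ ≤ δ)
    (bound : ∀ t, |t| < T → ‖y' t‖ ≤ K * ‖y t‖ + ε) :
    ∀ t, |t| < T → ‖y t‖ ≤ gronwallBound δ K ε |t| := by
  intro t ht
  rcases le_total 0 t with h | h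
  · rw [abs_of_nonneg h] at ht ⊢
    have := norm_le_gronwallBound_of_norm_deriv_right_le (f := y) (f' := y') (a := 0) (b := t)
      (fun s _ => (hy s).continuousAt.continuousWithinAt) (fun s _ => (hy s).hasDerivWithinAt) h0
      (fun s hs => bound s (by rw [abs_of_nonneg hs.1]; linarith [hs.2])) t ⟨h, le_rfl⟩
    simpa using this
  · rw [abs_of_nonpos h] at ht ⊢
    have hy' : ∀ s, HasDerivAt (fun s => y (-s)) (-y' (-s)) s := fun s => by
      simpa [Function.comp_def] using (hy (-s)).scomp s (hasDerivAt_neg s)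
    have := norm_le_gronwallBound_of_norm_deriv_right_le (f := fun s => y (-s))
      (f' := fun s => -y' (-s)) (a := 0) (b := -t) (δ := δ) (K := K) (ε := ε)
      (fun s _ => (hy' s).continuousAt.continuousWithinAt) (fun s _ => (hy' s).hasDerivWithinAt)
      (by simpa using h0)
      (fun s hs => by
        rw [norm_neg]
        exact bound (-s) (by rw [abs_neg, abs_of_nonneg hs.1]; linarith [hs.2])) (-t)
      ⟨by linarith, le_rfl⟩
    simpa using this

/-- A bounded field moves a point by at most `L * T` in time `T`, so Picard–Lindelöf on a ball of
that radius reaches all of `[-T, T]`. Uniqueness glues the pieces; the value at `t` is read from the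
piece with `T = ‖t‖₊ + 1`. -/
theorem exists_global_solution [CompleteSpace E] {f : E → E} {K L : ℝ≥0} (hf : LipschitzWith K f)
    (hb : ∀ x, ‖f x‖ ≤ L) (x₀ : E) :
    ∃ y : ℝ → E, y 0 = x₀ ∧ ∀ t, HasDerivAt y (f (y t)) t := by
  have h (T : ℝ≥0) : ∃ α : ℝ → E, α 0 = x₀ ∧
      ∀ t ∈ Ioo (-T : ℝ) T, HasDerivAt α (f (α t)) t := by
    have hp : IsPicardLindelof (fun _ : ℝ => f) (tmin := -T) (tmax := T)
        ⟨0, by simp⟩ x₀ (L * T) 0 L K :=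
      .of_time_independent (fun x _ => hb x) hf.lipschitzOnWith (by simp)
    obtain ⟨α, h0, hα⟩ := hp.exists_eq_forall_mem_Icc_hasDerivWithinAt₀
    exact ⟨α, h0, fun t ht => (hα t (Ioo_subset_Icc_self ht)).hasDerivAt (Icc_mem_nhds ht.1 ht.2)⟩
  choose α h0 hα using h
  have huniq (T T' : ℝ≥0) (hT : 0 < T) (hTT : T ≤ T') : EqOn (α T) (α T') (Ioo (-T : ℝ) T) := by
    have hTT' : (T : ℝ) ≤ T' := hTT
    have hT' : (0 : ℝ) < T := hT
    refine ODE_solution_unique_of_mem_Ioo (v := fun _ => f) (s := fun _ => univ) (K := K) (t₀ := 0)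
      (fun t _ => hf.lipschitzOnWith) ⟨by linarith, hT'⟩ (fun t ht => ⟨hα T t ht, mem_univ _⟩)
      (fun t ht => ⟨hα T' t ⟨by linarith [ht.1], by linarith [ht.2]⟩, mem_univ _⟩) ?_
    rw [h0, h0]
  refine ⟨fun t => α (‖t‖₊ + 1) t, h0 _, fun t => ?_⟩
  have hmem (s : ℝ) (T : ℝ≥0) (h : ‖s‖₊ < T) : s ∈ Ioo (-T : ℝ) T := by
    rw [mem_Ioo, ← abs_lt]
    exact_mod_cast h
  have hev : (fun s => α (‖s‖₊ + 1) s) =ᶠ[𝓝 t] α (‖t‖₊ + 2) := by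
    have : ∀ᶠ s in 𝓝 t, ‖s‖₊ < ‖t‖₊ + 1 :=
      (continuous_nnnorm.tendsto t).eventually (gt_mem_nhds (by simp))
    filter_upwards [this] with s hs
    refine huniq _ _ (by positivity) ?_ (hmem _ _ (by simp))
    calc ‖s‖₊ + 1 ≤ (‖t‖₊ + 1) + 1 := by gcongr
      _ = ‖t‖₊ + 2 := by rw [add_assoc, one_add_one_eq_two]
  have hd := hα (‖t‖₊ + 2) t (hmem _ _ (by simp))
  have := hd.congr_of_eventuallyEq hev
  rwa [← hev.eq_of_nhds] at this

/-- The flow of a bounded Lipschitz vector field. -/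
theorem exists_flow [CompleteSpace E] {f : E → E} {K L : ℝ≥0} (hf : LipschitzWith K f)
    (hb : ∀ x, ‖f x‖ ≤ L) :
    ∃ φ : ℝ → E → E, (∀ x, φ 0 x = x) ∧ (∀ t x, HasDerivAt (fun s => φ s x) (f (φ t x)) t) ∧
      (∀ t x y, ‖φ t x - φ t y‖ ≤ ‖x - y‖ * Real.exp (K * |t|)) ∧
      Continuous fun p : ℝ × E => φ p.1 p.2 := by
  choose φ h0 hφ using exists_global_solution hf hb
  have hlip (t : ℝ) (x y : E) : ‖φ x t - φ y t‖ ≤ ‖x - y‖ * Real.exp (K * |t|) := by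
    have := norm_le_gronwallBound_abs (y := fun t => φ x t - φ y t)
      (y' := fun t => f (φ x t) - f (φ y t)) (K := K) (ε := 0) (δ := ‖x - y‖) (T := |t| + 1)
      (fun t => (hφ x t).sub (hφ y t)) (by simp [h0])
      (fun s _ => by simpa using hf.norm_sub_le _ _) t (by linarith)
    rwa [gronwallBound_ε0] at this
  refine ⟨fun t x => φ x t, h0, fun t x => hφ x t, hlip, ?_⟩
  rw [continuous_iff_continuousAt]
  rintro ⟨t₀, x₀⟩
  rw [ContinuousAt, tendsto_iff_dist_tendsto_zero]
  have hlim : Tendsto (fun p : ℝ × E => ‖p.2 - x₀‖ * Real.exp (K * |p.1|) +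
      dist (φ x₀ p.1) (φ x₀ t₀)) (𝓝 (t₀, x₀)) (𝓝 0) := by
    have hc : ContinuousAt (fun p : ℝ × E => φ x₀ p.1) (t₀, x₀) :=
      ContinuousAt.comp (f := Prod.fst) (g := φ x₀) (hφ x₀ t₀).continuousAt continuousAt_fst
    have h1 : ContinuousAt (fun p : ℝ × E => ‖p.2 - x₀‖ * Real.exp (K * |p.1|) +
      dist (φ x₀ p.1) (φ x₀ t₀)) (t₀, x₀) := by
      refine ContinuousAt.add (by fun_prop) ?_
      exact hc.dist continuousAt_const
    simpa [ContinuousAt] using h1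
  refine squeeze_zero (fun _ => dist_nonneg) (fun p => ?_) hlim
  calc dist (φ p.2 p.1) (φ x₀ t₀) ≤ dist (φ p.2 p.1) (φ x₀ p.1) + dist (φ x₀ p.1) (φ x₀ t₀) :=
        dist_triangle _ _ _
    _ ≤ _ := by
      gcongr
      rw [dist_eq_norm]
      exact hlip _ _ _

theorem norm_taylor_le {f : E → E} {f' : E → E →L[ℝ] E} {M : ℝ≥0}
    (hf : ∀ x, HasFDerivAt f (f' x) x) (hM : LipschitzWith M f') (x y : E) :
    ‖f y - f x - f' x (y - x)‖ ≤ M * ‖y - x‖ ^ 2 := by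
  have := (convex_segment x y).norm_image_sub_le_of_norm_hasFDerivWithin_le'
    (f := f) (f' := f') (φ := f' x) (C := M * ‖y - x‖)
    (fun z _ => (hf z).hasFDerivWithinAt) (fun z hz => ?_)
    (left_mem_segment ℝ x y) (right_mem_segment ℝ x y)
  · rwa [mul_assoc, ← sq] at this
  · refine (hM.norm_sub_le z x).trans ?_
    gcongr
    rw [← dist_eq_norm, ← dist_eq_norm]
    have := dist_add_dist_of_mem_segment hz
    rw [dist_comm z x, dist_comm y x]
    linarith [dist_nonneg (x := z) (y := y)]

end Flow

/-! ### Differentiable dependence on the initial value -/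

section FlowDerivative

variable {E : Type*} [NormedAddCommGroup E] [NormedSpace ℝ E]

/-- Both terms of the bound are `o(z - x)`: the first by differentiability of `η`, the second
because it is quadratic in the increment of `η`. This passes differentiability from the curve of
initial values to the solutions. -/
theorem hasDerivAt_of_norm_sub_le {y : ℝ → E} {y' : E} {x C : ℝ} {η : ℝ → E}
    (hη : HasDerivAt η (deriv η x) x) 
    (h : ∀ᶠ z in 𝓝 x, ‖y z - y x - (z - x) • y'‖ ≤
      C * ‖η z - η x - (z - x) • deriv η x‖ + C * ‖η z - η x‖ ^ 2) :
    HasDerivAt y y' x := by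
  rw [hasDerivAt_iff_isLittleO] at hη ⊢
  have h2 : (fun z => C * ‖η z - η x - (z - x) • deriv η x‖ + C * ‖η z - η x‖ ^ 2)
      =o[𝓝 x] fun z => z - x := by
    refine (hη.norm_left.const_mul_left C).add (Asymptotics.IsLittleO.const_mul_left ?_ C)
    have h3 : (fun z => η z - η x) =O[𝓝 x] fun z => z - x := 
      (hasDerivAt_iff_isLittleO.2 hη).hasFDerivAt.isBigO_sub
    have h4 : (fun z => ‖η z - η x‖ ^ 2) =O[𝓝 x] fun z => (z - x) ^ 2 := h3.norm_left.pow 2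
    refine h4.trans_isLittleO ?_
    have h5 : (fun z : ℝ => z - x) =o[𝓝 x] fun _ => (1 : ℝ) := by
      rw [Asymptotics.isLittleO_one_iff]
      have : ContinuousAt (fun z : ℝ => z - x) x := by fun_prop
      simpa [ContinuousAt] using this
    have := h5.mul_isBigO (Asymptotics.isBigO_refl (fun z : ℝ => z - x) (𝓝 x))
    simpa [sq] using this
  refine Asymptotics.IsBigO.trans_isLittleO ?_ h2
  refine Asymptotics.IsBigO.of_bound 1 ?_
  filter_upwards [h] with z hz
  rw [one_mul]
  exact hz.trans (le_abs_self _)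

/-- A smooth bump times the identity; it serves to bound the linear part of the variational
equation. -/
theorem exists_lipschitz_cutoff (E : Type*) [NormedAddCommGroup E] [NormedSpace ℝ E]
    [FiniteDimensional ℝ E] {R : ℝ} (hR : 0 < R) : ∃ π : E → E, ∃ C : ℝ≥0,
    LipschitzWith C π ∧ (∀ z, ‖π z‖ ≤ ‖z‖) ∧ (∀ z, ‖π z‖ ≤ 2 * R) ∧ ∀ z, ‖z‖ ≤ R → π z = z := by
  let χ : ContDiffBump (0 : E) := ⟨R, 2 * R, hR, by linarith⟩
  have hs : ContDiff ℝ 1 fun z => χ z • z := χ.contDiff.smul contDiff_id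
  have hc : HasCompactSupport fun z => χ z • z := χ.hasCompactSupport.smul_right
  obtain ⟨C, hC⟩ := ContDiff.lipschitzWith_of_hasCompactSupport hc hs (by simp)
  refine ⟨fun z => χ z • z, C, hC, fun z => ?_, fun z => ?_, fun z hz => ?_⟩
  · rw [norm_smul, Real.norm_of_nonneg χ.nonneg]
    exact mul_le_of_le_one_left (norm_nonneg _) χ.le_one
  · rcases le_or_gt (2 * R) ‖z‖ with h | h
    · have : χ z = 0 := χ.zero_of_le_dist (by simpa using h)
      simp [this, hR.le]
    · rw [norm_smul, Real.norm_of_nonneg χ.nonneg]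
      exact (mul_le_of_le_one_left (norm_nonneg _) χ.le_one).trans h.le
  · have : χ z = 1 := χ.one_of_mem_closedBall (by simpa using hz)
    simp [this]

/-- The solutions of an autonomous equation with initial values `η ρ` depend continuously
differentiably on `(t, ρ)`, and their `ρ`-derivatives solve the variational equation. -/
theorem exists_contDiff_family [FiniteDimensional ℝ E] {f : E → E} {f' : E → E →L[ℝ] E} {K L M : ℝ≥0}
    (hf : ∀ x, HasFDerivAt f (f' x) x) (hL : ∀ x, ‖f x‖ ≤ L) (hK : ∀ x, ‖f' x‖ ≤ K)
    (hM : LipschitzWith M f') {η : ℝ → E} (hη : ContDiff ℝ 1 η) :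
    ∃ Y Z : ℝ → ℝ → E, (∀ ρ, Y 0 ρ = η ρ) ∧ (∀ ρ, Z 0 ρ = deriv η ρ) ∧
      (∀ t ρ, HasDerivAt (fun s => Y s ρ) (f (Y t ρ)) t) ∧
      (∀ t ρ, HasDerivAt (fun s => Z s ρ) (f' (Y t ρ) (Z t ρ)) t) ∧
      (∀ t ρ, HasDerivAt (fun r => Y t r) (Z t ρ) ρ) ∧
      ContDiff ℝ 1 fun p : ℝ × ℝ => Y p.1 p.2 := by
  have : CompleteSpace E := FiniteDimensional.complete ℝ E
  have hηd (x : ℝ) : HasDerivAt η (deriv η x) x := (hη.differentiable one_ne_zero x).hasDerivAt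
  have hη'c : Continuous (deriv η) := hη.continuous_deriv le_rfl
  have hfK : LipschitzWith K f :=
    lipschitzWith_of_nnnorm_fderiv_le (fun x => (hf x).differentiableAt)
      fun x => by rw [(hf x).fderiv]; exact hK x
  obtain ⟨φ, φ0, hφ, hφl, hφc⟩ := exists_flow hfK hL
  set Y : ℝ → ℝ → E := fun t ρ => φ t (η ρ) with hY
  have hYc : Continuous fun p : ℝ × ℝ => Y p.1 p.2 :=
    hφc.comp (continuous_fst.prodMk (hη.continuous.comp continuous_snd))
  -- local construction of the `ρ`-derivative, by truncating the linear part
  have key (R : ℝ) (hR : 0 < R) : ∃ Z : ℝ → ℝ → E, Continuous (fun p : ℝ × ℝ => Z p.1 p.2) ∧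
      ∀ T ρ, ‖deriv η ρ‖ * Real.exp (K * T) ≤ R → 
        Z 0 ρ = deriv η ρ ∧
        (∀ t, |t| < T → HasDerivAt (fun s => Z s ρ) (f' (Y t ρ) (Z t ρ)) t) ∧
        (∀ t, |t| < T → HasDerivAt (fun r => Y t r) (Z t ρ) ρ) := by
    obtain ⟨π, C, hπl, hπn, hπR, hπ⟩ := exists_lipschitz_cutoff E hR
    -- The dependence of `f' y z` on `y` grows with `z`, so the variational system is not globally
    -- Lipschitz. Cutting `z` off makes it so, and the flow theorem gives joint continuity of `Z`.
    set g : E × E → E × E := fun p => (f p.1, f' p.1 (π p.2)) with hg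
    have hgl : LipschitzWith (max K (M * (2 * R).toNNReal + K * C)) g := by
      have h1 : LipschitzWith K fun p : E × E => f p.1 := by
        simpa [Function.comp_def] using hfK.comp LipschitzWith.prod_fst
      have h2 : LipschitzWith (M * (2 * R).toNNReal + K * C) 
          fun p : E × E => f' p.1 (π p.2) := by
        refine LipschitzWith.of_dist_le_mul fun p q => ?_
        have hpq1 : ‖p.1 - q.1‖ ≤ ‖p - q‖ := norm_fst_le (p - q)
        have hpq2 : ‖p.2 - q.2‖ ≤ ‖p - q‖ := norm_snd_le (p - q)
        rw [dist_eq_norm, dist_eq_norm]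
        have e : f' p.1 (π p.2) - f' q.1 (π q.2) =
            (f' p.1 - f' q.1) (π p.2) + f' q.1 (π p.2 - π q.2) := by simp
        rw [e]
        calc _ ≤ ‖f' p.1 - f' q.1‖ * ‖π p.2‖ + ‖f' q.1‖ * ‖π p.2 - π q.2‖ :=
              (norm_add_le _ _).trans (add_le_add (ContinuousLinearMap.le_opNorm _ _)
                (ContinuousLinearMap.le_opNorm _ _))
          _ ≤ (M * ‖p - q‖) * (2 * R) + K * (C * ‖p - q‖) := by
              gcongr
              · exact (hM.norm_sub_le _ _).trans (by gcongr)
              · exact hπR _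
              · exact hK _
              · exact (hπl.norm_sub_le _ _).trans (by gcongr)
          _ = _ := by
              push_cast
              rw [Real.coe_toNNReal _ (by positivity)]
              ring
      exact h1.prodMk h2
    have hgb (p : E × E) : ‖g p‖ ≤ (max L (K * (2 * R).toNNReal) : ℝ≥0) := by
      rw [Prod.norm_def, NNReal.coe_max]
      refine max_le_max (hL _) ?_
      refine (ContinuousLinearMap.le_opNorm _ _).trans ?_
      rw [NNReal.coe_mul, Real.coe_toNNReal _ (by positivity)]
      gcongr
      · exact hK _
      · exact hπR _
    obtain ⟨ψ, ψ0, hψ, -, hψc⟩ := exists_flow hgl hgb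
    have hψ1 (t ρ : ℝ) : (ψ t (η ρ, deriv η ρ)).1 = Y t ρ := by
      have := ODE_solution_unique_univ (v := fun _ => f) (s := fun _ => univ) (K := K) (t₀ := 0)
        (f := fun t => (ψ t (η ρ, deriv η ρ)).1) (g := fun t => Y t ρ)
        (fun t => hfK.lipschitzOnWith) (fun t => ⟨(hψ t (η ρ, deriv η ρ)).fst, mem_univ _⟩)
        (fun t => ⟨hφ t (η ρ), mem_univ _⟩) (by simp [ψ0, hY, φ0])
      exact congrFun this t
    set Z : ℝ → ℝ → E := fun t ρ => (ψ t (η ρ, deriv η ρ)).2 with hZ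
    have hZ0 (ρ : ℝ) : Z 0 ρ = deriv η ρ := by simp [hZ, ψ0]
    have hZd (t ρ : ℝ) : HasDerivAt (fun s => Z s ρ) (f' (Y t ρ) (π (Z t ρ))) t := by
      have : HasDerivAt (fun s => (ψ s (η ρ, deriv η ρ)).2) (g (ψ t (η ρ, deriv η ρ))).2 t :=
        (hψ t (η ρ, deriv η ρ)).snd
      rwa [show (g (ψ t (η ρ, deriv η ρ))).2 = f' (Y t ρ) (π (Z t ρ)) by simp [hg, hψ1, hZ]] at this
    have hZb (t ρ : ℝ) : ‖Z t ρ‖ ≤ ‖deriv η ρ‖ * Real.exp (K * |t|) := by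
      have := norm_le_gronwallBound_abs (y := fun t => Z t ρ) (K := K) (ε := 0) (T := |t| + 1)
        (δ := ‖deriv η ρ‖) (fun t => hZd t ρ) (by simp [hZ0]) (fun s _ => by
          rw [add_zero]
          refine (ContinuousLinearMap.le_opNorm _ _).trans ?_
          gcongr
          · exact hK _
          · exact hπn _) t (by linarith)
      rwa [gronwallBound_ε0] at this
    refine ⟨Z, ?_, fun T ρ hTρ => ?_⟩
    · exact continuous_snd.comp (hψc.comp (continuous_fst.prodMk
        ((hη.continuous.comp continuous_snd).prodMk (hη'c.comp continuous_snd))))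
    -- The Grönwall bound keeps `Z` in the ball of radius `R`, where the cut-off acts as the
    -- identity.
    have hZπ (t : ℝ) (ht : |t| < T) : π (Z t ρ) = Z t ρ := by
      refine hπ _ ((hZb t ρ).trans (le_trans ?_ hTρ))
      gcongr
    refine ⟨hZ0 ρ, fun t ht => by simpa only [hZπ t ht] using hZd t ρ, fun t ht => ?_⟩
    have hT : 0 < T := (abs_nonneg t).trans_lt ht
    set A : ℝ := Real.exp ((K + 1) * T) + M * Real.exp (K * T) ^ 2 * Real.exp ((K + 1) * T) with hA
    refine hasDerivAt_of_norm_sub_le (η := η) (C := A) (hηd ρ) (Eventually.of_forall fun r => ?_)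
    -- The first-order error solves the linearised equation up to a quadratic Taylor remainder. The
    -- rate `K + 1` replaces `K` so that the formula for a nonzero rate applies.
    have hw := norm_le_gronwallBound_abs (T := T) (K := K + 1)
      (y := fun t => Y t r - Y t ρ - (r - ρ) • Z t ρ)
      (δ := ‖η r - η ρ - (r - ρ) • deriv η ρ‖)
      (ε := M * (‖η r - η ρ‖ * Real.exp (K * T)) ^ 2)
      (fun t => ((hφ t (η r)).sub (hφ t (η ρ))).sub ((hZd t ρ).const_smul (r - ρ)))
      (by simp [hY, φ0, hZ0]) (fun s hs => by
        rw [hZπ s hs]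
        have e : f (φ s (η r)) - f (φ s (η ρ)) - (r - ρ) • f' (Y s ρ) (Z s ρ) =
          (f (Y s r) - f (Y s ρ) - f' (Y s ρ) (Y s r - Y s ρ)) +
            f' (Y s ρ) (Y s r - Y s ρ - (r - ρ) • Z s ρ) := by
          simp [hY]
        rw [e, add_comm]
        refine (norm_add_le _ _).trans (add_le_add ?_ ?_)
        · refine (ContinuousLinearMap.le_opNorm _ _).trans ?_
          gcongr
          exact (hK _).trans (by linarith)
        · refine (norm_taylor_le hf hM _ _).trans ?_
          gcongr
          refine (hφl s (η r) (η ρ)).trans ?_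
          gcongr) t ht
    refine hw.trans ?_
    have hK1 : (K : ℝ) + 1 ≠ 0 := by positivity
    rw [gronwallBound_of_K_ne_0 hK1]
    have h1 : Real.exp ((K + 1) * |t|) ≤ Real.exp ((K + 1) * T) := by
      gcongr
    have h2 : 1 ≤ Real.exp ((K + 1) * |t|) := Real.one_le_exp (by positivity)
    set X := ‖η r - η ρ - (r - ρ) • deriv η ρ‖
    set D := ‖η r - η ρ‖
    have h3 : M * (D * Real.exp (K * T)) ^ 2 / (K + 1) * (Real.exp ((K + 1) * |t|) - 1) ≤
        M * (D * Real.exp (K * T)) ^ 2 * Real.exp ((K + 1) * T) := by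
      apply mul_le_mul _ _ (by linarith) (by positivity)
      · exact div_le_self (by positivity) (by linarith [K.coe_nonneg])
      · linarith
    calc _ ≤ X * Real.exp ((K + 1) * T) + 
          M * (D * Real.exp (K * T)) ^ 2 * Real.exp ((K + 1) * T) :=
          add_le_add (mul_le_mul_of_nonneg_left h1 (norm_nonneg _)) h3
      _ = Real.exp ((K + 1) * T) * X + 
          (M * Real.exp (K * T) ^ 2 * Real.exp ((K + 1) * T)) * D ^ 2 := by ring
      _ ≤ A * X + A * D ^ 2 := by
        gcongr
        · rw [hA]; exact le_add_of_nonneg_right (by positivity)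
        · rw [hA]; exact le_add_of_nonneg_left (by positivity)
  -- The local constructions depend on `R`. Naming the limit `deriv` makes them agree, by uniqueness
  -- of derivatives.
  set Z : ℝ → ℝ → E := fun t ρ => deriv (fun r => Y t r) ρ with hZ
  have hloc (t₀ ρ₀ : ℝ) : ∃ W : ℝ → ℝ → E, Continuous (fun p : ℝ × ℝ => W p.1 p.2) ∧
      W 0 ρ₀ = deriv η ρ₀ ∧ 0 < |t₀| + 1 ∧
      HasDerivAt (fun s => W s ρ₀) (f' (Y t₀ ρ₀) (W t₀ ρ₀)) t₀ ∧
      ∀ᶠ ρ in 𝓝 ρ₀, ∀ t, |t| < |t₀| + 1 → HasDerivAt (fun r => Y t r) (W t ρ) ρ := by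
    -- The extra `1` leaves room for all `ρ` near `ρ₀`.
    set R := ‖deriv η ρ₀‖ * Real.exp (K * (|t₀| + 1)) + 1 with hRdef
    obtain ⟨W, hWc, hW⟩ := key R (by positivity)
    have hle : ‖deriv η ρ₀‖ * Real.exp (K * (|t₀| + 1)) ≤ R := by linarith
    refine ⟨W, hWc, (hW _ _ hle).1, by positivity, (hW _ _ hle).2.1 t₀ (by linarith), ?_⟩
    have hc : Continuous fun ρ => ‖deriv η ρ‖ * Real.exp (K * (|t₀| + 1)) := by fun_prop
    filter_upwards [(hc.tendsto ρ₀).eventually (gt_mem_nhds (lt_add_one _))] with ρ hρ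
    exact (hW (|t₀| + 1) ρ hρ.le).2.2
  have hev (t₀ ρ₀ : ℝ) : ∃ W : ℝ → ℝ → E, Continuous (fun p : ℝ × ℝ => W p.1 p.2) ∧
      W 0 ρ₀ = deriv η ρ₀ ∧ HasDerivAt (fun s => W s ρ₀) (f' (Y t₀ ρ₀) (W t₀ ρ₀)) t₀ ∧
      (∀ t, |t| < |t₀| + 1 → Z t ρ₀ = W t ρ₀) ∧
      ∀ᶠ p : ℝ × ℝ in 𝓝 (t₀, ρ₀), HasDerivAt (fun r => Y p.1 r) (W p.1 p.2) p.2 := by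
    obtain ⟨W, hWc, hW0, -, hWd, hWe⟩ := hloc t₀ ρ₀
    refine ⟨W, hWc, hW0, hWd, fun t ht => (hWe.self_of_nhds t ht).deriv, ?_⟩
    have ht : ∀ᶠ t in 𝓝 t₀, |t| < |t₀| + 1 :=
      (continuous_abs.tendsto t₀).eventually (gt_mem_nhds (lt_add_one _))
    rw [nhds_prod_eq]
    filter_upwards [ht.prod_mk hWe] with p hp using hp.2 _ hp.1
  have hZY (t ρ : ℝ) : HasDerivAt (fun r => Y t r) (Z t ρ) ρ := by
    obtain ⟨W, -, -, -, -, h⟩ := hev t ρ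
    exact h.self_of_nhds.differentiableAt.hasDerivAt
  have hZc : Continuous fun p : ℝ × ℝ => Z p.1 p.2 := by
    rw [continuous_iff_continuousAt]
    rintro ⟨t₀, ρ₀⟩
    obtain ⟨W, hWc, -, -, -, h⟩ := hev t₀ ρ₀
    refine hWc.continuousAt.congr ?_
    filter_upwards [h] with p hp using hp.deriv.symm
  refine ⟨Y, Z, fun ρ => φ0 _, fun ρ => ?_, fun t ρ => hφ t _, fun t ρ => ?_, hZY, ?_⟩
  · obtain ⟨W, -, hW0, -, h, -⟩ := hev 0 ρ
    rw [h 0 (by simp), hW0]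
  · obtain ⟨W, -, -, hWd, h, -⟩ := hev t ρ
    rw [h t (by linarith)]
    refine hWd.congr_of_eventuallyEq ?_
    filter_upwards [(continuous_abs.tendsto t).eventually (gt_mem_nhds (lt_add_one _))] with s hs
      using h s hs
  · rw [contDiff_one_iff_hasFDerivAt]
    have hfc : Continuous fun p : ℝ × ℝ => f (Y p.1 p.2) := hfK.continuous.comp hYc
    let D1 : ℝ → ℝ → ℝ →L[ℝ] E := fun t ρ => ContinuousLinearMap.toSpanSingleton ℝ (f (Y t ρ))
    let D2 : ℝ → ℝ → ℝ →L[ℝ] E := fun t ρ => ContinuousLinearMap.toSpanSingleton ℝ (Z t ρ)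
    have hT : Continuous fun v : E => (ContinuousLinearMap.toSpanSingleton ℝ v : ℝ →L[ℝ] E) :=
      (ContinuousLinearMap.toSpanSingletonCLE (𝕜 := ℝ) (E := E)).continuous
    have hD1 : Continuous (Function.uncurry D1) := hT.comp hfc
    have hD2 : Continuous (Function.uncurry D2) := hT.comp hZc
    refine ⟨fun p => (D1 p.1 p.2).coprod (D2 p.1 p.2), ?_, fun p => ?_⟩
    · exact (ContinuousLinearMap.coprodEquivL ℝ).continuous.comp (hD1.prodMk hD2)
    · exact (hasStrictFDerivAt_uncurry_coprod (f := Y) (f₁ := D1) (f₂ := D2) (u := p)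
        (Eventually.of_forall fun v => (hφ v.1 _).hasFDerivAt)
        (Eventually.of_forall fun v => (hZY v.1 v.2).hasFDerivAt)
        hD1.continuousAt hD2.continuousAt).hasFDerivAt

end FlowDerivative

/-! ### Barriers: a priori bounds along characteristics -/

section Barrier

/-- If finitely many functions start positive, and each of them has a positive derivative whenever
it vanishes while the others are nonnegative, then they all stay positive. -/
theorem pos_of_deriv_pos_on_boundary {ι : Type*} [Finite ι] {g g' : ι → ℝ → ℝ}
    (hg : ∀ i t, 0 ≤ t → HasDerivAt (g i) (g' i t) t) (h0 : ∀ i, 0 < g i 0)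
    (h : ∀ t, 0 < t → (∀ i, 0 ≤ g i t) → ∀ i, g i t = 0 → 0 < g' i t) :
    ∀ t, 0 ≤ t → ∀ i, 0 < g i t := by
  by_contra! hcon
  obtain ⟨T, hT, i₀, hi₀⟩ := hcon
  set S : Set ℝ := Icc 0 T ∩ {t | ∃ i, g i t ≤ 0} with hS
  have hSc : IsClosed S := by
    have : S = ⋃ i, Icc 0 T ∩ g i ⁻¹' Iic 0 := by
      ext t; simp [hS]
    rw [this]
    refine isClosed_iUnion_of_finite fun i => ?_
    exact ContinuousOn.preimage_isClosed_of_isClosed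
      (fun t ht => (hg i t ht.1).continuousAt.continuousWithinAt) isClosed_Icc isClosed_Iic
  have hSne : S.Nonempty := ⟨T, ⟨hT, le_rfl⟩, i₀, hi₀⟩
  have hSb : BddBelow S := ⟨0, fun t ht => ht.1.1⟩
  obtain ⟨⟨ht0, htT⟩, i, hi⟩ := hSc.csInf_mem hSne hSb
  -- The first time at which some `g i` vanishes. Left difference quotients there are nonpositive,
  -- against the assumed sign of the derivative.
  set t₁ := sInf S
  have hlt (s : ℝ) (hs0 : 0 ≤ s) (hs : s < t₁) (j : ι) : 0 < g j s := by
    by_contra! hj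
    exact absurd (csInf_le hSb ⟨⟨hs0, hs.le.trans htT⟩, j, hj⟩) (not_le.2 hs)
  have htpos : 0 < t₁ := by
    rcases ht0.eq_or_lt with h1 | h1
    · rw [← h1] at hi
      exact absurd hi (not_le.2 (h0 i))
    · exact h1
  have hev : ∀ᶠ s in 𝓝[<] t₁, 0 ≤ s :=
    (eventually_ge_nhds htpos).filter_mono nhdsWithin_le_nhds
  have hnn (j : ι) : 0 ≤ g j t₁ := by
    refine ge_of_tendsto ((hg j t₁ ht0).continuousAt.tendsto.mono_left
      (nhdsWithin_le_nhds (s := Iio t₁))) ?_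
    filter_upwards [hev, self_mem_nhdsWithin] with s hs hs' using (hlt s hs hs' j).le
  have hz : g i t₁ = 0 := le_antisymm hi (hnn i)
  have hd := h t₁ htpos hnn i hz
  have hsl := (hasDerivAt_iff_tendsto_slope.1 (hg i t₁ ht0)).mono_left
    (nhdsWithin_mono t₁ (s := Iio t₁) fun s hs => ne_of_lt hs)
  have hle : g' i t₁ ≤ 0 := by
    refine le_of_tendsto hsl ?_
    filter_upwards [hev, self_mem_nhdsWithin] with s hs (hs' : s < t₁)
    rw [slope_def_field, hz]
    exact div_nonpos_of_nonneg_of_nonpos (by linarith [hlt s hs hs' i]) (by linarith)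
  linarith

end Barrier

/-- A priori bounds for the (possibly truncated) characteristic system. -/
theorem characteristic_bounds {D A B ν : ℝ} {F G l χ : ℝ → ℝ} (hD : 1 ≤ D) (hA : 1 ≤ A)
    (hB : 0 ≤ B) (hν : 8 * D * (B + 1) ≤ ν)
    (hF : ∀ t, 0 ≤ t → HasDerivAt F (χ t * (-F t ^ 2 - ν * F t - G t)) t)
    (hG : ∀ t, 0 ≤ t → HasDerivAt G (χ t * (F t * (1 - D * G t))) t)
    (hl : ∀ t, 0 ≤ t → HasDerivAt l (χ t * F t) t)
    (hχ : ∀ t, |F t| ≤ ν + B + 2 * A + 2 → |G t| ≤ 2 * A + 1 → χ t = 1)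
    (hF0 : |F 0| ≤ B) (hN0 : 0 < 1 - D * G 0) (hN0A : 1 - D * G 0 ≤ A) (hl0 : l 0 = 0) :
    ∀ t, 0 ≤ t → -(ν / (8 * D)) < F t ∧ F t < B + 2 * A + 2 ∧ 0 < 1 - D * G t ∧
      1 - D * G t < 2 * A + 1 ∧ 1 - D * G t = (1 - D * G 0) * Real.exp (-(D * l t)) ∧ χ t = 1 := by
  have hD0 : 0 < D := by linarith
  have hν8 : 8 ≤ ν := by nlinarith
  have hν0 : 0 < ν := by linarith
  -- `N exp (D l)` is conserved, with or without the cut-off. Positivity of `N` must come from here: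
  -- at `N = 0` its derivative vanishes, so the strict barrier argument does not see it.
  have hN (t : ℝ) (ht : 0 ≤ t) : 1 - D * G t = (1 - D * G 0) * Real.exp (-(D * l t)) := by
    have hd (s : ℝ) (hs : 0 ≤ s) :
        HasDerivAt (fun s => (1 - D * G s) * Real.exp (D * l s)) 0 s := by
      have h1 := (((hG s hs).const_mul D).const_sub 1).mul ((hl s hs).const_mul D).exp
      refine h1.congr_deriv ?_
      ring
    have hc : (1 - D * G t) * Real.exp (D * l t) = (1 - D * G 0) * Real.exp (D * l 0) := by
      refine constant_of_has_deriv_right_zero (f := fun s => (1 - D * G s) * Real.exp (D * l s))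
        (fun s hs => (hd s hs.1).continuousAt.continuousWithinAt)
        (fun s hs => (hd s hs.1).hasDerivWithinAt) t ⟨ht, le_rfl⟩
    rw [hl0, mul_zero, Real.exp_zero, mul_one] at hc
    rw [← hc, mul_assoc, ← Real.exp_add]
    simp
  have hNpos (t : ℝ) (ht : 0 ≤ t) : 0 < 1 - D * G t := by
    rw [hN t ht]; positivity
  -- Chosen so that the terms linear in `F` cancel in the derivative of `2A + βF - N` on its zero
  -- set.
  set β : ℝ := 2 * A * D / ν with hβ
  have hβν : β * ν = 2 * A * D := by rw [hβ]; field_simp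
  have hβ0 : 0 < β := by positivity
  have hq : ν / (8 * D) * (8 * D) = ν := by field_simp
  set γ := ν / (8 * D) with hγ
  have hγ0 : 0 < γ := by positivity
  have hγB : B + 1 ≤ γ := by rw [hγ, le_div_iff₀ (by positivity)]; linarith
  have hγν : γ ≤ ν / 8 := by nlinarith
  have hβγ : β * γ * 4 = A := by
    have : β * (γ * (8 * D)) = 2 * A * D := by rw [hq, hβν]
    have h2 : D * (β * γ * 4) = D * A := by linarith
    exact mul_left_cancel₀ hD0.ne' h2
  have hgeom (t : ℝ) (ht : 0 ≤ t) (h1 : 0 ≤ F t + γ) (h3 : 0 ≤ 2 * A + 1 - (1 - D * G t))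
      (h4 : 0 ≤ B + 2 * A + 2 - F t) : χ t = 1 := by
    have hNt := hNpos t ht
    apply hχ t
    · rw [abs_le]; constructor <;> linarith
    · rw [abs_le]
      constructor
      · nlinarith
      · nlinarith
  -- The sign of `N'` is that of `-F`, so a bound on `N` alone is not a barrier. The second function
  -- couples `N` to `F`: if `N` reaches `2A + 1`, it forces `βF ≥ 1`, hence `N' < 0`. The first and
  -- last functions use that friction dominates at both ends of the range of `F`.
  let g : Fin 4 → ℝ → ℝ := ![fun t => F t + γ, fun t => 2 * A + β * F t - (1 - D * G t),
    fun t => 2 * A + 1 - (1 - D * G t), fun t => B + 2 * A + 2 - F t]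
  let g' : Fin 4 → ℝ → ℝ := ![fun t => χ t * (-F t ^ 2 - ν * F t - G t),
    fun t => β * (χ t * (-F t ^ 2 - ν * F t - G t)) + D * (χ t * (F t * (1 - D * G t))),
    fun t => D * (χ t * (F t * (1 - D * G t))), fun t => -(χ t * (-F t ^ 2 - ν * F t - G t))]
  have hF0' := abs_le.1 hF0
  have hg : ∀ t, 0 ≤ t → ∀ i, 0 < g i t := by
    refine pos_of_deriv_pos_on_boundary (g := g) (g' := g') ?_ ?_ ?_
    · intro i t ht
      fin_cases i
      · exact (hF t ht).add_const _
      · refine ((((hF t ht).const_mul β).const_add (2 * A)).sub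
          (((hG t ht).const_mul D).const_sub 1)).congr_deriv ?_
        simp only [g', Matrix.cons_val_zero, Matrix.cons_val_one, Fin.mk_one]
        ring
      · refine ((((hG t ht).const_mul D).const_sub 1).const_sub (2 * A + 1)).congr_deriv ?_
        simp [g']
      · exact (hF t ht).const_sub _
    · intro i
      fin_cases i
      · change 0 < F 0 + γ
        linarith
      · change 0 < 2 * A + β * F 0 - (1 - D * G 0)
        nlinarith
      · change 0 < 2 * A + 1 - (1 - D * G 0)
        linarith
      · change 0 < B + 2 * A + 2 - F 0
        linarith
    · intro t ht hall
      have h1 : 0 ≤ F t + γ := hall 0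
      have h2 : 0 ≤ 2 * A + β * F t - (1 - D * G t) := hall 1
      have h3 : 0 ≤ 2 * A + 1 - (1 - D * G t) := hall 2
      have h4 : 0 ≤ B + 2 * A + 2 - F t := hall 3
      have hχ1 := hgeom t ht.le h1 h3 h4
      have hNt := hNpos t ht.le
      intro i hi
      fin_cases i
      · change F t + γ = 0 at hi
        change 0 < χ t * (-F t ^ 2 - ν * F t - G t)
        have hFt : F t = -γ := by linarith
        have hG1 : G t < 1 := by nlinarith
        rw [hχ1, hFt]
        nlinarith
      · change 2 * A + β * F t - (1 - D * G t) = 0 at hi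
        change 0 < β * (χ t * (-F t ^ 2 - ν * F t - G t)) + D * (χ t * (F t * (1 - D * G t)))
        have e1 : 1 - D * G t = 2 * A + β * F t := by linarith
        have e2 : D * G t = 1 - 2 * A - β * F t := by linarith
        rw [hχ1, e1]
        have hbF : -A ≤ 4 * (β * F t) := by nlinarith
        have h5 : 0 < D * (β * (1 * (-F t ^ 2 - ν * F t - G t)) +
            D * (1 * (F t * (2 * A + β * F t)))) := by
          have : D * (β * (1 * (-F t ^ 2 - ν * F t - G t)) +
            D * (1 * (F t * (2 * A + β * F t)))) = D * (D - 1) * β * F t ^ 2 +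
              D * F t * (2 * A * D - β * ν) - β * (D * G t) := by ring
          rw [this, hβν, e2]
          have h6 : 0 ≤ D * (D - 1) * β * F t ^ 2 := by
            have : 0 ≤ D - 1 := by linarith
            positivity
          have h7 : 0 < β * (2 * A - 1 + β * F t) := mul_pos hβ0 (by linarith)
          linarith
        exact (mul_pos_iff_of_pos_left hD0).1 h5
      · change 2 * A + 1 - (1 - D * G t) = 0 at hi
        change 0 < D * (χ t * (F t * (1 - D * G t)))
        have hFt : 0 < F t := by
          have : 1 ≤ β * F t := by linarith
          exact (mul_pos_iff_of_pos_left hβ0).1 (by linarith)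
        rw [hχ1]
        positivity
      · change B + 2 * A + 2 - F t = 0 at hi
        change 0 < -(χ t * (-F t ^ 2 - ν * F t - G t))
        have hFt : F t = B + 2 * A + 2 := by linarith
        have hG1 : -(2 * A) ≤ G t := by nlinarith
        rw [hχ1]
        nlinarith [sq_nonneg (F t)]
  intro t ht
  have h1 : 0 < F t + γ := hg t ht 0
  have h3 : 0 < 2 * A + 1 - (1 - D * G t) := hg t ht 2
  have h4 : 0 < B + 2 * A + 2 - F t := hg t ht 3
  exact ⟨by linarith, by linarith, hNpos t ht, by linarith, hN t ht, hgeom t ht h1.le h3.le h4.le⟩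

/-- Positivity of the Jacobian factor along a characteristic. -/
theorem jacobian_pos {B K ν κ : ℝ} {F N x a : ℝ → ℝ} (hB : 0 ≤ B) (hν : 8 * (B + 1) ≤ ν)
    (hK : 8 * K < ν ^ 2)
    (hF : ∀ t, 0 ≤ t → -(ν / 8) ≤ F t) (hN : ∀ t, 0 ≤ t → 0 < N t) (hNK : ∀ t, 0 ≤ t → N t ≤ K)
    (hκ : 0 < κ) (hx : ∀ t, 0 ≤ t → HasDerivAt x (a t) t)
    (ha : ∀ t, 0 ≤ t → HasDerivAt a (-(ν + 2 * F t) * a t - (N t * x t - N t * κ)) t)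
    (hx0 : x 0 = 1) (ha0 : -B ≤ a 0) :
    ∀ t, 0 ≤ t → Real.exp (-(ν / 2) * t) / 2 < x t := by
  -- Here `a = x'`. The first barrier says that `x` cannot decay faster than rate `ν / 4`; the
  -- second compares with a faster exponential and makes that positivity strict.
  let g : Fin 2 → ℝ → ℝ := ![fun t => a t + ν / 4 * x t, fun t => x t - Real.exp (-(ν / 2) * t) / 2]
  let g' : Fin 2 → ℝ → ℝ := ![fun t => -(ν + 2 * F t) * a t - (N t * x t - N t * κ) + ν / 4 * a t,
    fun t => a t + ν / 4 * Real.exp (-(ν / 2) * t)]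
  have hg : ∀ t, 0 ≤ t → ∀ i, 0 < g i t := by
    refine pos_of_deriv_pos_on_boundary (g := g) (g' := g') ?_ ?_ ?_
    · intro i t ht
      fin_cases i
      · exact (ha t ht).add ((hx t ht).const_mul (ν / 4))
      · have he : HasDerivAt (fun t => Real.exp (-(ν / 2) * t))
            (Real.exp (-(ν / 2) * t) * (-(ν / 2) * 1)) t :=
          ((hasDerivAt_id t).const_mul (-(ν / 2))).exp
        refine ((hx t ht).sub (he.div_const 2)).congr_deriv ?_
        simp only [g', Matrix.cons_val_one, Fin.mk_one, Matrix.cons_val_zero]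
        ring
    · intro i
      fin_cases i
      · change 0 < a 0 + ν / 4 * x 0
        rw [hx0]
        linarith
      · change 0 < x 0 - Real.exp (-(ν / 2) * 0) / 2
        rw [hx0]
        norm_num
    · intro t ht hall
      have h1 : 0 ≤ a t + ν / 4 * x t := hall 0
      have h2 : 0 ≤ x t - Real.exp (-(ν / 2) * t) / 2 := hall 1
      have he := Real.exp_pos (-(ν / 2) * t)
      have hxt : 0 < x t := by linarith
      have hNt := hN t ht.le
      have hFt := hF t ht.le
      have hNt' := hNK t ht.le
      intro i hi
      fin_cases i
      · change a t + ν / 4 * x t = 0 at hi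
        change 0 < -(ν + 2 * F t) * a t - (N t * x t - N t * κ) + ν / 4 * a t
        have hat : a t = -(ν / 4 * x t) := by linarith
        rw [hat]
        have h3 : 0 < N t * κ := by positivity
        -- With `F ≥ -ν / 8` the bracket is at least `ν² / 8 - K`, positive by `hK`.
        have h4 : 0 < ((3 * ν / 4 + 2 * F t) * (ν / 4) - N t) * x t := by
          refine mul_pos ?_ hxt
          nlinarith
        nlinarith
      · change x t - Real.exp (-(ν / 2) * t) / 2 = 0 at hi
        change 0 < a t + ν / 4 * Real.exp (-(ν / 2) * t)
        have : x t = Real.exp (-(ν / 2) * t) / 2 := by linarith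
        rw [this] at h1
        have : 0 < ν * Real.exp (-(ν / 2) * t) := mul_pos (by linarith) he
        linarith
  intro t ht
  have : 0 < x t - Real.exp (-(ν / 2) * t) / 2 := hg t ht 1
  linarith

/-! ### The truncated characteristic system and its `C^1` family -/

section Truncation

/-- The vector field of the characteristic system in the variables `(F, G, log q)`. -/
noncomputable def charField (D ν : ℝ) (p : ℝ × ℝ) : ℝ × ℝ × ℝ :=
  (-p.1 ^ 2 - ν * p.1 - p.2, p.1 * (1 - D * p.2), p.1)

theorem contDiff_charField (D ν : ℝ) {n : WithTop ℕ∞} : ContDiff ℝ n (charField D ν) := by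
  unfold charField
  fun_prop

theorem fderiv_charField_apply (D ν : ℝ) (p w : ℝ × ℝ) : fderiv ℝ (charField D ν) p w =
    (-(2 * p.1 * w.1) - ν * w.1 - w.2, w.1 * (1 - D * p.2) - D * p.1 * w.2, w.1) := by
  have h1 : HasFDerivAt (fun p : ℝ × ℝ => p.1) (ContinuousLinearMap.fst ℝ ℝ ℝ) p := hasFDerivAt_fst
  have h2 : HasFDerivAt (fun p : ℝ × ℝ => p.2) (ContinuousLinearMap.snd ℝ ℝ ℝ) p := hasFDerivAt_snd
  have := ((((h1.pow 2).neg.sub (h1.const_mul ν)).sub h2).prodMk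
    ((h1.mul ((h2.const_mul D).const_sub 1)).prodMk h1))
  have h3 : HasFDerivAt (charField D ν) _ p := this
  rw [h3.fderiv]
  simp
  ring

/-- The projection `(F, G, log q) ↦ (F, G)`. -/
def charProj : ℝ × ℝ × ℝ →L[ℝ] ℝ × ℝ :=
  (ContinuousLinearMap.fst ℝ ℝ (ℝ × ℝ)).prod
    ((ContinuousLinearMap.fst ℝ ℝ ℝ).comp (ContinuousLinearMap.snd ℝ ℝ (ℝ × ℝ)))

/-- A family of solutions of the characteristic system, with cut-off `χ`, that is `C^1` in
`(t, ρ)`. -/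
theorem exists_truncated_family (D ν : ℝ) {R : ℝ} (hR : 0 < R) {F₀ G₀ : ℝ → ℝ}
    (hF₀ : ContDiff ℝ 1 F₀) (hG₀ : ContDiff ℝ 1 G₀) :
    ∃ (χ : ℝ × ℝ → ℝ) (F G l Fρ Gρ lρ : ℝ → ℝ → ℝ),
      (∀ p : ℝ × ℝ, |p.1| ≤ R → |p.2| ≤ R → χ p = 1) ∧
      ContDiff ℝ 1 (fun p : ℝ × ℝ => F p.1 p.2) ∧ ContDiff ℝ 1 (fun p : ℝ × ℝ => G p.1 p.2) ∧
      ContDiff ℝ 1 (fun p : ℝ × ℝ => l p.1 p.2) ∧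
      (∀ ρ, F 0 ρ = F₀ ρ) ∧ (∀ ρ, G 0 ρ = G₀ ρ) ∧ (∀ ρ, l 0 ρ = 0) ∧
      (∀ ρ, Fρ 0 ρ = deriv F₀ ρ) ∧ (∀ ρ, Gρ 0 ρ = deriv G₀ ρ) ∧ (∀ ρ, lρ 0 ρ = 0) ∧
      (∀ t ρ, HasDerivAt (F t) (Fρ t ρ) ρ) ∧ (∀ t ρ, HasDerivAt (G t) (Gρ t ρ) ρ) ∧
      (∀ t ρ, HasDerivAt (l t) (lρ t ρ) ρ) ∧
      (∀ t ρ, HasDerivAt (fun s => F s ρ)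
        (χ (F t ρ, G t ρ) * (-F t ρ ^ 2 - ν * F t ρ - G t ρ)) t) ∧
      (∀ t ρ, HasDerivAt (fun s => G s ρ) (χ (F t ρ, G t ρ) * (F t ρ * (1 - D * G t ρ))) t) ∧
      (∀ t ρ, HasDerivAt (fun s => l s ρ) (χ (F t ρ, G t ρ) * F t ρ) t) ∧
      ∀ t ρ, |F t ρ| < R → |G t ρ| < R →
        HasDerivAt (fun s => Fρ s ρ) (-(2 * F t ρ * Fρ t ρ) - ν * Fρ t ρ - Gρ t ρ) t ∧
        HasDerivAt (fun s => Gρ s ρ) (Fρ t ρ * (1 - D * G t ρ) - D * F t ρ * Gρ t ρ) t ∧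
        HasDerivAt (fun s => lρ s ρ) (Fρ t ρ) t := by
  let χ : ContDiffBump (0 : ℝ × ℝ) := ⟨R, 2 * R, hR, by linarith⟩
  -- Only `(F, G)` is cut off: the field does not depend on `log q`, which need not stay bounded.
  set k : ℝ × ℝ → ℝ × ℝ × ℝ := fun p => χ p • charField D ν p with hk
  have hks : ContDiff ℝ 2 k := χ.contDiff.smul (contDiff_charField D ν)
  have hkc : HasCompactSupport k := χ.hasCompactSupport.smul_right
  have hk's : ContDiff ℝ 1 (fderiv ℝ k) := hks.fderiv_right (by norm_num)
  have hk'c : HasCompactSupport (fderiv ℝ k) := hkc.fderiv ℝ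
  obtain ⟨M, hM⟩ := ContDiff.lipschitzWith_of_hasCompactSupport hk'c hk's one_ne_zero
  obtain ⟨L, hL⟩ := hks.continuous.bounded_above_of_compact_support hkc
  obtain ⟨K, hK⟩ := hk's.continuous.bounded_above_of_compact_support hk'c
  have hL0 : 0 ≤ L := (norm_nonneg _).trans (hL 0)
  have hK0 : 0 ≤ K := (norm_nonneg _).trans (hK 0)
  lift L to ℝ≥0 using hL0
  lift K to ℝ≥0 using hK0
  have hf (y : ℝ × ℝ × ℝ) : HasFDerivAt (fun y => k (charProj y))
      ((fderiv ℝ k (charProj y)).comp charProj) y :=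
    ((hks.differentiable two_ne_zero) (charProj y)).hasFDerivAt.comp y charProj.hasFDerivAt
  have hη : ContDiff ℝ 1 fun ρ => (F₀ ρ, G₀ ρ, (0 : ℝ)) := hF₀.prodMk (hG₀.prodMk contDiff_const)
  obtain ⟨Y, Z, hY0, hZ0, hYt, hZt, hYρ, hYc⟩ := exists_contDiff_family
    (f := fun y => k (charProj y)) (f' := fun y => (fderiv ℝ k (charProj y)).comp charProj)
    (L := L) (K := K * ‖charProj‖₊) (M := M * ‖charProj‖₊ * ‖charProj‖₊)
    hf (fun y => hL _)
    (fun y => (ContinuousLinearMap.opNorm_comp_le _ _).trans (by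
      rw [NNReal.coe_mul]
      exact mul_le_mul_of_nonneg_right (hK _) (norm_nonneg _)))
    (LipschitzWith.of_dist_le_mul fun y z => by
      rw [dist_eq_norm, dist_eq_norm, ← ContinuousLinearMap.sub_comp]
      refine (ContinuousLinearMap.opNorm_comp_le _ _).trans ?_
      have h1 : ‖charProj y - charProj z‖ ≤ ‖charProj‖ * ‖y - z‖ := by
        rw [← map_sub]; exact charProj.le_opNorm _
      calc _ ≤ (M * (‖charProj‖ * ‖y - z‖)) * ‖charProj‖ := by
            gcongr
            exact (hM.norm_sub_le _ _).trans (by gcongr)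
        _ = _ := by push_cast; ring) hη
  have hη' (ρ : ℝ) : deriv (fun ρ => (F₀ ρ, G₀ ρ, (0 : ℝ))) ρ = (deriv F₀ ρ, deriv G₀ ρ, 0) :=
    ((hF₀.differentiable one_ne_zero ρ).hasDerivAt.prodMk
      ((hG₀.differentiable one_ne_zero ρ).hasDerivAt.prodMk (hasDerivAt_const ρ (0 : ℝ)))).deriv
  have fstD {y : ℝ → ℝ × ℝ × ℝ} {y' : ℝ × ℝ × ℝ} {t : ℝ} (h : HasDerivAt y y' t) :
      HasDerivAt (fun s => (y s).1) y'.1 t := h.fst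
  have sndD {y : ℝ → ℝ × ℝ × ℝ} {y' : ℝ × ℝ × ℝ} {t : ℝ} (h : HasDerivAt y y' t) :
      HasDerivAt (fun s => (y s).2.1) y'.2.1 t := by
    have h2 : HasDerivAt (fun s => (y s).2) y'.2 t := h.snd
    exact h2.fst
  have trdD {y : ℝ → ℝ × ℝ × ℝ} {y' : ℝ × ℝ × ℝ} {t : ℝ} (h : HasDerivAt y y' t) :
      HasDerivAt (fun s => (y s).2.2) y'.2.2 t := by
    have h2 : HasDerivAt (fun s => (y s).2) y'.2 t := h.snd
    exact h2.snd
  refine ⟨χ, fun t ρ => (Y t ρ).1, fun t ρ => (Y t ρ).2.1, fun t ρ => (Y t ρ).2.2,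
    fun t ρ => (Z t ρ).1, fun t ρ => (Z t ρ).2.1, fun t ρ => (Z t ρ).2.2, ?_,
    contDiff_fst.comp hYc, contDiff_fst.comp (contDiff_snd.comp hYc),
    contDiff_snd.comp (contDiff_snd.comp hYc), fun ρ => by simp only [hY0], fun ρ => by simp only [hY0],
    fun ρ => by simp only [hY0], fun ρ => by simp only [hZ0, hη'], fun ρ => by simp only [hZ0, hη'],
    fun ρ => by simp only [hZ0, hη'], fun t ρ => fstD (hYρ t ρ), fun t ρ => sndD (hYρ t ρ),
    fun t ρ => trdD (hYρ t ρ), fun t ρ => fstD (hYt t ρ), fun t ρ => sndD (hYt t ρ),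
    fun t ρ => trdD (hYt t ρ), fun t ρ hFR hGR => ?_⟩
  · intro p h1 h2
    refine χ.one_of_mem_closedBall ?_
    rw [mem_closedBall_zero_iff, Prod.norm_def]
    exact max_le h1 h2
  -- In the open box the cut-off is `1` near the point, so its derivative does not enter the
  -- variational equation.
  · have hev : k =ᶠ[𝓝 (charProj (Y t ρ))] charField D ν := by
      have : charProj (Y t ρ) ∈ Metric.ball (0 : ℝ × ℝ) R := by
        rw [mem_ball_zero_iff, Prod.norm_def]
        exact max_lt hFR hGR
      filter_upwards [χ.eventuallyEq_one_of_mem_ball this] with p hp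
      simp [hk, hp]
    have hz := hZt t ρ
    rw [ContinuousLinearMap.comp_apply, hev.fderiv_eq, fderiv_charField_apply] at hz
    exact ⟨fstD hz, sndD hz, trdD hz⟩

end Truncation

/-- A `C^1` family of characteristics, parametrised by the initial radius `ρ ≥ 0`: along the curve
`r = ρ exp (l t ρ)` the radial coefficients of the solution are `F t ρ` and `G t ρ`. -/
structure IsCharFamily (D ν A B : ℝ) (F₀ G₀ : ℝ → ℝ) (F G l Fρ Gρ lρ : ℝ → ℝ → ℝ) : Prop where
  contDiff_F : ContDiff ℝ 1 (fun p : ℝ × ℝ => F p.1 p.2)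
  contDiff_G : ContDiff ℝ 1 (fun p : ℝ × ℝ => G p.1 p.2)
  contDiff_l : ContDiff ℝ 1 (fun p : ℝ × ℝ => l p.1 p.2)
  F_zero : ∀ ρ, F 0 ρ = F₀ ρ
  G_zero : ∀ ρ, G 0 ρ = G₀ ρ
  l_zero : ∀ ρ, l 0 ρ = 0
  Fρ_zero : ∀ ρ, Fρ 0 ρ = deriv F₀ ρ
  Gρ_zero : ∀ ρ, Gρ 0 ρ = deriv G₀ ρ
  hasDerivAt_F_snd : ∀ t ρ, HasDerivAt (F t) (Fρ t ρ) ρ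
  hasDerivAt_G_snd : ∀ t ρ, HasDerivAt (G t) (Gρ t ρ) ρ
  hasDerivAt_l_snd : ∀ t ρ, HasDerivAt (l t) (lρ t ρ) ρ
  hasDerivAt_F : ∀ t ρ, 0 ≤ t → 0 ≤ ρ →
    HasDerivAt (fun s => F s ρ) (-F t ρ ^ 2 - ν * F t ρ - G t ρ) t
  hasDerivAt_G : ∀ t ρ, 0 ≤ t → 0 ≤ ρ → HasDerivAt (fun s => G s ρ) (F t ρ * (1 - D * G t ρ)) t
  hasDerivAt_l : ∀ t ρ, 0 ≤ t → 0 ≤ ρ → HasDerivAt (fun s => l s ρ) (F t ρ) t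
  hasDerivAt_Fρ : ∀ t ρ, 0 ≤ t → 0 ≤ ρ →
    HasDerivAt (fun s => Fρ s ρ) (-(2 * F t ρ * Fρ t ρ) - ν * Fρ t ρ - Gρ t ρ) t
  hasDerivAt_Gρ : ∀ t ρ, 0 ≤ t → 0 ≤ ρ →
    HasDerivAt (fun s => Gρ s ρ) (Fρ t ρ * (1 - D * G t ρ) - D * F t ρ * Gρ t ρ) t
  lt_F : ∀ t ρ, 0 ≤ t → 0 ≤ ρ → -(ν / 8) < F t ρ
  F_lt : ∀ t ρ, 0 ≤ t → 0 ≤ ρ → F t ρ < B + 2 * A + 2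
  N_pos : ∀ t ρ, 0 ≤ t → 0 ≤ ρ → 0 < 1 - D * G t ρ
  N_lt : ∀ t ρ, 0 ≤ t → 0 ≤ ρ → 1 - D * G t ρ < 2 * A + 1
  lt_jacobian : ∀ t ρ, 0 ≤ t → 0 ≤ ρ → Real.exp (-(ν / 2) * t) / 2 < 1 + ρ * lρ t ρ
  Gρ_eq : ∀ t ρ, 0 ≤ t → 0 ≤ ρ → ρ * Gρ t ρ = (1 - D * G t ρ) *
    (1 + ρ * lρ t ρ - (1 - D * G₀ ρ - ρ * deriv G₀ ρ) / (1 - D * G₀ ρ))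

/-- The bounds place every trajectory with `t, ρ ≥ 0` strictly inside the box where the cut-off is
`1`, so both the truncated equations and their variations are the genuine ones. -/
theorem exists_charFamily {D A B ν : ℝ} (hD : 1 ≤ D) (hA : 1 ≤ A) (hB : 0 ≤ B)
    (hν : 8 * D * (B + 1) ≤ ν) (hνA : 8 * (2 * A + 1) < ν ^ 2) {F₀ G₀ : ℝ → ℝ}
    (hF₀ : ContDiff ℝ 1 F₀) (hG₀ : ContDiff ℝ 1 G₀) (hF₀B : ∀ ρ, 0 ≤ ρ → |F₀ ρ| ≤ B)
    (hF₀B' : ∀ ρ, 0 ≤ ρ → |ρ * deriv F₀ ρ| ≤ B) (hN₀ : ∀ ρ, 0 ≤ ρ → 0 < 1 - D * G₀ ρ)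
    (hN₀A : ∀ ρ, 0 ≤ ρ → 1 - D * G₀ ρ ≤ A)
    (hn₀ : ∀ ρ, 0 ≤ ρ → 0 < 1 - D * G₀ ρ - ρ * deriv G₀ ρ) :
    ∃ F G l Fρ Gρ lρ : ℝ → ℝ → ℝ, IsCharFamily D ν A B F₀ G₀ F G l Fρ Gρ lρ := by
  have hν8 : 8 * (B + 1) ≤ ν := by nlinarith
  have hν0 : 0 < ν := by linarith
  obtain ⟨χ, F, G, l, Fρ, Gρ, lρ, hχ, cF, cG, cl, F0, G0, l0, Fρ0, Gρ0, lρ0, dFρ, dGρ, dlρ, dF, dG,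
    dl, hvar⟩ := exists_truncated_family D ν (R := ν + B + 2 * A + 3) (by linarith) hF₀ hG₀
  have hb (ρ : ℝ) (hρ : 0 ≤ ρ) := characteristic_bounds (F := fun t => F t ρ) (G := fun t => G t ρ)
    (l := fun t => l t ρ) (χ := fun t => χ (F t ρ, G t ρ)) hD hA hB hν (fun t _ => dF t ρ)
    (fun t _ => dG t ρ) (fun t _ => dl t ρ)
    (fun t h1 h2 => hχ _ (by linarith) (by linarith))
    (by simpa only [F0] using hF₀B ρ hρ) (by simpa only [G0] using hN₀ ρ hρ)
    (by simpa only [G0] using hN₀A ρ hρ) (l0 ρ)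
  have hχ1 (t ρ : ℝ) (ht : 0 ≤ t) (hρ : 0 ≤ ρ) : χ (F t ρ, G t ρ) = 1 :=
    (hb ρ hρ t ht).2.2.2.2.2
  have hγ : ν / (8 * D) ≤ ν / 8 := by
    apply div_le_div_of_nonneg_left hν0.le (by norm_num) (by linarith)
  have hFl (t ρ : ℝ) (ht : 0 ≤ t) (hρ : 0 ≤ ρ) : -(ν / 8) < F t ρ := by
    linarith [(hb ρ hρ t ht).1]
  have hG' (t ρ : ℝ) (ht : 0 ≤ t) (hρ : 0 ≤ ρ) :
      HasDerivAt (fun s => G s ρ) (F t ρ * (1 - D * G t ρ)) t := by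
    have := dG t ρ
    rwa [hχ1 t ρ ht hρ, one_mul] at this
  have hv (t ρ : ℝ) (ht : 0 ≤ t) (hρ : 0 ≤ ρ) := hvar t ρ
    (by
      have := (hb ρ hρ t ht).2.1
      have := hFl t ρ ht hρ
      rw [abs_lt]; constructor <;> linarith)
    (by
      have h1 := (hb ρ hρ t ht).2.2.1
      have h2 := (hb ρ hρ t ht).2.2.2.1
      rw [abs_lt]; constructor <;> nlinarith)
  -- The logarithmic `ρ`-derivative of the conserved `N exp (D l)`, multiplied by `ρ / D`; the
  -- quotient of initial data is `κ`.
  have hGρ (t ρ : ℝ) (ht : 0 ≤ t) (hρ : 0 ≤ ρ) : ρ * Gρ t ρ = (1 - D * G t ρ) *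
      (1 + ρ * lρ t ρ - (1 - D * G₀ ρ - ρ * deriv G₀ ρ) / (1 - D * G₀ ρ)) := by
    have hd (s : ℝ) (hs : 0 ≤ s) : HasDerivAt
        (fun s => 1 + ρ * lρ s ρ - ρ * Gρ s ρ / (1 - D * G s ρ)) 0 s := by
      have hN := (hb ρ hρ s hs).2.2.1
      have h1 := (((hv s ρ hs hρ).2.2.const_mul ρ).const_add 1).sub
        (((hv s ρ hs hρ).2.1.const_mul ρ).div (((hG' s ρ hs hρ).const_mul D).const_sub 1) hN.ne')
      refine h1.congr_deriv ?_
      have hN' : 1 - D * G s ρ ≠ 0 := hN.ne'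
      field_simp
      ring
    have hc := constant_of_has_deriv_right_zero (a := 0) (b := t)
      (f := fun s => 1 + ρ * lρ s ρ - ρ * Gρ s ρ / (1 - D * G s ρ))
      (fun s hs => (hd s hs.1).continuousAt.continuousWithinAt)
      (fun s hs => (hd s hs.1).hasDerivWithinAt) t ⟨ht, le_rfl⟩
    have hN : 1 - D * G t ρ ≠ 0 := (hb ρ hρ t ht).2.2.1.ne'
    have hN0 : 1 - D * G₀ ρ ≠ 0 := (hN₀ ρ hρ).ne'
    simp only [lρ0, Gρ0, G0] at hc
    have h2 : (1 - D * G₀ ρ - ρ * deriv G₀ ρ) / (1 - D * G₀ ρ) =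
        1 + ρ * 0 - ρ * deriv G₀ ρ / (1 - D * G₀ ρ) := by field_simp; ring
    rw [h2, ← hc]
    field_simp
    ring
  refine ⟨F, G, l, Fρ, Gρ, lρ, cF, cG, cl, F0, G0, l0, Fρ0, Gρ0, dFρ, dGρ, dlρ, ?_, hG', ?_,
    fun t ρ ht hρ => (hv t ρ ht hρ).1, fun t ρ ht hρ => (hv t ρ ht hρ).2.1,
    hFl, fun t ρ ht hρ => (hb ρ hρ t ht).2.1,
    fun t ρ ht hρ => (hb ρ hρ t ht).2.2.1, fun t ρ ht hρ => (hb ρ hρ t ht).2.2.2.1, ?_, hGρ⟩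
  · intro t ρ ht hρ
    have := dF t ρ
    rwa [hχ1 t ρ ht hρ, one_mul] at this
  · intro t ρ ht hρ
    have := dl t ρ
    rwa [hχ1 t ρ ht hρ, one_mul] at this
  · intro t ρ ht hρ
    -- Through `hGρ` the pair `x = 1 + ρ lρ`, `a = ρ Fρ` obeys the forced oscillator; `κ > 0` is
    -- where positivity of `n₀` enters.
    refine jacobian_pos (B := B) (K := 2 * A + 1) (ν := ν)
      (κ := (1 - D * G₀ ρ - ρ * deriv G₀ ρ) / (1 - D * G₀ ρ)) (F := fun t => F t ρ)
      (N := fun t => 1 - D * G t ρ) (x := fun t => 1 + ρ * lρ t ρ) (a := fun t => ρ * Fρ t ρ)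
      hB hν8 hνA (fun s hs => (hFl s ρ hs hρ).le) (fun s hs => (hb ρ hρ s hs).2.2.1)
      (fun s hs => (hb ρ hρ s hs).2.2.2.1.le) (div_pos (hn₀ ρ hρ) (hN₀ ρ hρ))
      (fun s hs => ((hv s ρ hs hρ).2.2.const_mul ρ).const_add 1) (fun s hs => ?_)
      (by simp [lρ0]) (by simpa only [Fρ0] using (abs_le.1 (hF₀B' ρ hρ)).1) t ht
    refine ((hv s ρ hs hρ).1.const_mul ρ).congr_deriv ?_
    have := hGρ s ρ hs hρ
    linear_combination -this

/-! ### Exponential decay along characteristics -/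

section Decay

theorem le_mul_exp_of_deriv_le {m m' Φ Φ' : ℝ → ℝ} (hm : ∀ t, 0 ≤ t → HasDerivAt m (m' t) t)
    (hΦ : ∀ t, 0 ≤ t → HasDerivAt Φ (Φ' t) t) (h : ∀ t, 0 ≤ t → m' t ≤ Φ' t * m t) :
    ∀ t, 0 ≤ t → m t ≤ m 0 * Real.exp (Φ t - Φ 0) := by
  intro t ht
  have hd (s : ℝ) (hs : 0 ≤ s) : HasDerivAt (fun s => m s * Real.exp (-Φ s))
      ((m' s - Φ' s * m s) * Real.exp (-Φ s)) s := by
    refine ((hm s hs).mul (hΦ s hs).neg.exp).congr_deriv ?_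
    simp only [Pi.neg_apply]
    ring
  have hanti : AntitoneOn (fun s => m s * Real.exp (-Φ s)) (Ici 0) := by
    refine antitoneOn_of_hasDerivWithinAt_nonpos (convex_Ici 0)
      (f' := fun s => (m' s - Φ' s * m s) * Real.exp (-Φ s))
      (fun s hs => (hd s hs).continuousAt.continuousWithinAt)
      (fun s hs => (hd s (interior_subset hs)).hasDerivWithinAt) fun s hs => ?_
    have := h s (interior_subset hs)
    exact mul_nonpos_of_nonpos_of_nonneg (by linarith) (Real.exp_pos _).le
  have h1 : m t * Real.exp (-Φ t) ≤ m 0 * Real.exp (-Φ 0) := hanti (mem_Ici.2 le_rfl) ht ht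
  calc m t = m t * Real.exp (-Φ t) * Real.exp (Φ t) := by
        rw [mul_assoc, ← Real.exp_add]; simp
    _ ≤ m 0 * Real.exp (-Φ 0) * Real.exp (Φ t) := by gcongr
    _ = _ := by rw [mul_assoc, ← Real.exp_add]; ring_nf

/-- The sharp decay rate of the overdamped oscillator persists under perturbations whose
coefficients decay exponentially. -/
theorem exists_decay_of_perturbation {a b K κ : ℝ} (ha : 0 < a) (hab : a < b) (hab1 : a * b = 1)
    (hK : 0 ≤ K) (hκ : 0 < κ) : ∃ C, 0 < C ∧ ∀ p s R S : ℝ → ℝ,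
      (∀ t, 0 ≤ t → HasDerivAt p (-(a + b) * p t - s t + R t) t) →
      (∀ t, 0 ≤ t → HasDerivAt s (p t + S t) t) →
      (∀ t, 0 ≤ t → |R t| ≤ K * Real.exp (-κ * t) * (|p t| + |s t|)) →
      (∀ t, 0 ≤ t → |S t| ≤ K * Real.exp (-κ * t) * (|p t| + |s t|)) →
      ∀ t, 0 ≤ t → |p t| + |s t| ≤ C * (|p 0| + |s 0|) * Real.exp (-(a * t)) := by
  have hb : 0 < b := ha.trans hab
  set δ := b - a with hδ
  have hδ0 : 0 < δ := sub_pos.2 hab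
  set Q := 4 * K * (1 + b) ^ 2 / δ with hQ
  have hQ0 : 0 ≤ Q := by positivity
  refine ⟨(1 + b) / δ * (2 * (1 + b)) * Real.exp (Q / (2 * κ)), by positivity, ?_⟩
  intro p s R S hp hs hR hS t ht
  -- Coordinates diagonalising the unperturbed system: since `ab = 1`, `c' = -b c` and `e' = -a e`.
  set c : ℝ → ℝ := fun t => p t + a * s t with hc
  set e : ℝ → ℝ := fun t => p t + b * s t with he
  have hinv (t : ℝ) : |p t| + |s t| ≤ (1 + b) / δ * (|c t| + |e t|) := by
    have h1 : s t = (e t - c t) / δ := by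
      rw [eq_div_iff hδ0.ne']; simp only [hc, he, hδ]; ring
    have h2 : p t = (b * c t - a * e t) / δ := by
      rw [eq_div_iff hδ0.ne']; simp only [hc, he, hδ]; ring
    have h3 : |s t| ≤ (|c t| + |e t|) / δ := by
      rw [h1, abs_div, abs_of_pos hδ0]
      gcongr
      linarith [abs_sub (e t) (c t)]
    have h4 : |p t| ≤ (b * (|c t| + |e t|)) / δ := by
      rw [h2, abs_div, abs_of_pos hδ0]
      gcongr
      have := abs_sub (b * c t) (a * e t)
      rw [abs_mul, abs_mul, abs_of_pos ha, abs_of_pos hb] at this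
      nlinarith [abs_nonneg (e t)]
    calc _ ≤ (b * (|c t| + |e t|)) / δ + (|c t| + |e t|) / δ := add_le_add h4 h3
      _ = _ := by ring
  have hdir (t : ℝ) (k : ℝ) (hk : 0 < k) (hkb : k ≤ b) (x y : ℝ) :
      |x + k * y| ≤ (1 + b) * max |x| |y| := by
    have h1 := abs_add_le x (k * y)
    rw [abs_mul, abs_of_pos hk] at h1
    have h2 := le_max_left |x| |y|
    have h3 := le_max_right |x| |y|
    nlinarith [abs_nonneg y]
  have hder (t : ℝ) (ht : 0 ≤ t) : HasDerivAt (fun t => c t ^ 2 + e t ^ 2)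
      (2 * c t * (-b * c t + (R t + a * S t)) + 2 * e t * (-a * e t + (R t + b * S t))) t := by
    have h1 : HasDerivAt c (-b * c t + (R t + a * S t)) t := by
      refine ((hp t ht).add ((hs t ht).const_mul a)).congr_deriv ?_
      simp only [hc]
      linear_combination s t * hab1
    have h2 : HasDerivAt e (-a * e t + (R t + b * S t)) t := by
      refine ((hp t ht).add ((hs t ht).const_mul b)).congr_deriv ?_
      simp only [he]
      linear_combination s t * hab1
    refine ((h1.pow 2).add (h2.pow 2)).congr_deriv ?_
    push_cast
    ring
  -- The perturbation adds the integrable rate `Q exp (-κt)` to `-2a`, at a total cost of at most `Q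
  -- / κ`; passing from squares to absolute values halves it.
  have hΦ (t : ℝ) : HasDerivAt (fun t => -(2 * a * t) - Q / κ * Real.exp (-κ * t))
      (-(2 * a) + Q * Real.exp (-κ * t)) t := by
    have h1 : HasDerivAt (fun t => Real.exp (-κ * t)) (Real.exp (-κ * t) * (-κ * 1)) t :=
      ((hasDerivAt_id t).const_mul (-κ)).exp
    refine (((hasDerivAt_id t).const_mul (2 * a)).neg.sub (h1.const_mul (Q / κ))).congr_deriv ?_
    field_simp
    ring
  have hm := le_mul_exp_of_deriv_le hder (fun t _ => hΦ t) (fun t ht => by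
    set E := Real.exp (-κ * t) with hE
    have hE0 : 0 < E := Real.exp_pos _
    set M := (1 + b) * (K * E * ((1 + b) / δ * (|c t| + |e t|))) with hM
    have hmax : max |R t| |S t| ≤ K * E * ((1 + b) / δ * (|c t| + |e t|)) := by
      refine (max_le (hR t ht) (hS t ht)).trans ?_
      gcongr
      exact hinv t
    have h1 : |R t + a * S t| ≤ M := (hdir t a ha hab.le _ _).trans (by rw [hM]; gcongr)
    have h2 : |R t + b * S t| ≤ M := (hdir t b hb le_rfl _ _).trans (by rw [hM]; gcongr)
    have h3 : c t * (R t + a * S t) ≤ |c t| * M :=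
      (le_abs_self _).trans (by rw [abs_mul]; gcongr)
    have h4 : e t * (R t + b * S t) ≤ |e t| * M :=
      (le_abs_self _).trans (by rw [abs_mul]; gcongr)
    have h5 : (|c t| + |e t|) * M * 2 ≤ Q * E * (c t ^ 2 + e t ^ 2) := by
      have h6 : (|c t| + |e t|) ^ 2 ≤ 2 * (c t ^ 2 + e t ^ 2) := by
        rw [← sq_abs (c t), ← sq_abs (e t)]
        nlinarith [sq_nonneg (|c t| - |e t|)]
      calc (|c t| + |e t|) * M * 2 = 2 * K * (1 + b) ^ 2 / δ * E * (|c t| + |e t|) ^ 2 := by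
            rw [hM]; ring
        _ ≤ 2 * K * (1 + b) ^ 2 / δ * E * (2 * (c t ^ 2 + e t ^ 2)) := by gcongr
        _ = _ := by rw [hQ]; ring
    nlinarith [mul_nonneg hδ0.le (sq_nonneg (c t))]) t ht
  have hexp : -(2 * a * t) - Q / κ * Real.exp (-κ * t) -
      (-(2 * a * 0) - Q / κ * Real.exp (-κ * 0)) ≤ Q / κ - 2 * (a * t) := by
    have : 0 ≤ Q / κ * Real.exp (-κ * t) := by positivity
    simp only [mul_zero, Real.exp_zero]
    linarith
  set X := |p 0| + |s 0| with hX
  have hX0 : 0 ≤ X := by positivity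
  have hm0 : c 0 ^ 2 + e 0 ^ 2 ≤ 2 * ((1 + b) * X) ^ 2 := by
    have hmx : max |p 0| |s 0| ≤ X := max_le (by simp [hX]) (by simp [hX])
    have h1 : |c 0| ≤ (1 + b) * X := (hdir 0 a ha hab.le _ _).trans (by gcongr)
    have h2 : |e 0| ≤ (1 + b) * X := (hdir 0 b hb le_rfl _ _).trans (by gcongr)
    have h3 := sq_le_sq' (by linarith [abs_nonneg (c 0), neg_abs_le (c 0)]) ((le_abs_self _).trans h1)
    have h4 := sq_le_sq' (by linarith [abs_nonneg (e 0), neg_abs_le (e 0)]) ((le_abs_self _).trans h2)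
    linarith
  have hfin : |c t| + |e t| ≤ 2 * (1 + b) * X * (Real.exp (Q / (2 * κ)) * Real.exp (-(a * t))) := by
    refine abs_le_of_sq_le_sq' ?_ (by positivity) |>.2
    have h6 : (|c t| + |e t|) ^ 2 ≤ 2 * (c t ^ 2 + e t ^ 2) := by
      rw [← sq_abs (c t), ← sq_abs (e t)]
      nlinarith [sq_nonneg (|c t| - |e t|)]
    have h7 : (Real.exp (Q / (2 * κ)) * Real.exp (-(a * t))) ^ 2 =
        Real.exp (Q / κ - 2 * (a * t)) := by
      rw [← Real.exp_add, ← Real.exp_nat_mul]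
      congr 1
      push_cast
      field_simp
      ring
    calc _ ≤ 2 * (c t ^ 2 + e t ^ 2) := h6
      _ ≤ 2 * (2 * ((1 + b) * X) ^ 2 * Real.exp (Q / κ - 2 * (a * t))) := by
        gcongr
        refine hm.trans ?_
        gcongr
      _ = _ := by rw [mul_pow (2 * (1 + b) * X), h7]; ring
  calc _ ≤ (1 + b) / δ * (|c t| + |e t|) := hinv t
    _ ≤ (1 + b) / δ * (2 * (1 + b) * X * (Real.exp (Q / (2 * κ)) * Real.exp (-(a * t)))) := by
      gcongr
    _ = _ := by ring

theorem sub_one_sub_log_le {N : ℝ} (hN : 0 < N) : N - 1 - Real.log N ≤ (N - 1) ^ 2 / N := by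
  have := Real.one_sub_inv_le_log_of_pos hN
  have h : (N - 1) ^ 2 / N = N - 2 + N⁻¹ := by field_simp; ring
  rw [h]; linarith

/-- With `r = √N`, the inequality `log r ≤ r - 1` makes the right side at least `(r - 1)²`, while
`(r² - 1)² ≤ 2 (r² + 1) (r - 1)²`. -/
theorem le_sub_one_sub_log {N : ℝ} (hN : 0 < N) :
    (N - 1) ^ 2 / (2 * (N + 1)) ≤ N - 1 - Real.log N := by
  set r := Real.sqrt N with hr
  have hr0 : 0 < r := Real.sqrt_pos.2 hN
  have hr2 : r ^ 2 = N := Real.sq_sqrt hN.le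
  have h1 : Real.log N ≤ 2 * (r - 1) := by
    rw [← hr2, Real.log_pow]
    push_cast
    linarith [Real.log_le_sub_one_of_pos hr0]
  have h2 : (N - 1) ^ 2 / (2 * (N + 1)) ≤ (r - 1) ^ 2 := by
    rw [div_le_iff₀ (by positivity), ← hr2]
    nlinarith [mul_nonneg (sq_nonneg (r - 1)) (sq_nonneg (r - 1))]
  nlinarith

/-- The Lyapunov function of the characteristic system. -/
noncomputable def lyapunov (D ε F G : ℝ) : ℝ :=
  F ^ 2 / 2 + (1 - D * G - 1 - Real.log (1 - D * G)) / D ^ 2 + ε * (F * G)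

/-- The convex term `N - 1 - log N` is quadratic in `G` once `N` is bounded away from `0`, and `ε`
is small enough to absorb the cross term. -/
theorem lyapunov_le {D ε F G m a : ℝ} (hD : 1 ≤ D) (ha : 0 ≤ a) (hm0 : 0 < m) (hε0 : 0 < ε)
    (hεa : ε * (2 * (a + 1)) ≤ 1) (hm : m ≤ 1 - D * G) :
    lyapunov D ε F G ≤ (1 + 1 / m) * (F ^ 2 + G ^ 2) := by
  have hD0 : 0 < D := by linarith
  have h1 : (1 - D * G - 1 - Real.log (1 - D * G)) / D ^ 2 ≤ G ^ 2 / m := by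
    rw [div_le_iff₀ (by positivity)]
    refine (sub_one_sub_log_le (hm0.trans_le hm)).trans ?_
    calc (1 - D * G - 1) ^ 2 / (1 - D * G) ≤ (1 - D * G - 1) ^ 2 / m := by gcongr
      _ = _ := by ring
  have h2 : ε * (F * G) ≤ 1 / 2 * (F ^ 2 + G ^ 2) := by
    have : ε ≤ 1 := by nlinarith
    nlinarith [sq_nonneg (F - G), sq_nonneg (F + G)]
  have h3 : 0 ≤ F ^ 2 / m := by positivity
  have h4 : (1 + 1 / m) * (F ^ 2 + G ^ 2) = F ^ 2 + G ^ 2 + F ^ 2 / m + G ^ 2 / m := by ring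
  have h5 := sq_nonneg F
  have h6 := sq_nonneg G
  rw [lyapunov, h4]
  linarith

theorem le_lyapunov {D ε F G a : ℝ} (hD : 1 ≤ D) (ha : 0 ≤ a) (hε0 : 0 < ε)
    (hεa : ε * (2 * (a + 1)) ≤ 1) (hN : 0 < 1 - D * G) (hNa : 1 - D * G ≤ a) :
    (F ^ 2 + G ^ 2) / (4 * (a + 1)) ≤ lyapunov D ε F G := by
  have hD0 : 0 < D := by linarith
  have h1 : G ^ 2 / (2 * (a + 1)) ≤ (1 - D * G - 1 - Real.log (1 - D * G)) / D ^ 2 := by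
    rw [le_div_iff₀ (by positivity)]
    refine le_trans ?_ (le_sub_one_sub_log hN)
    calc G ^ 2 / (2 * (a + 1)) * D ^ 2 = (1 - D * G - 1) ^ 2 / (2 * (a + 1)) := by ring
      _ ≤ _ := by gcongr
  have h2 : -(ε * (F * G)) ≤ (F ^ 2 + G ^ 2) / (4 * (a + 1)) := by
    rw [le_div_iff₀ (by positivity)]
    have h5 : -(F * G) * 2 ≤ F ^ 2 + G ^ 2 := by nlinarith [sq_nonneg (F + G)]
    have h6 : 0 ≤ F ^ 2 + G ^ 2 := by positivity
    calc -(ε * (F * G)) * (4 * (a + 1)) = (ε * (2 * (a + 1))) * (-(F * G) * 2) := by ring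
      _ ≤ (ε * (2 * (a + 1))) * (F ^ 2 + G ^ 2) := by gcongr
      _ ≤ 1 * (F ^ 2 + G ^ 2) := by gcongr
      _ = _ := one_mul _
  have h3 : F ^ 2 / (2 * (a + 1)) ≤ F ^ 2 / 2 := by gcongr; linarith
  have h4 : (F ^ 2 + G ^ 2) / (4 * (a + 1)) * 2 =
      F ^ 2 / (2 * (a + 1)) + G ^ 2 / (2 * (a + 1)) := by field_simp; ring
  rw [lyapunov]
  linarith

/-- The left side is the derivative of `lyapunov` along the system. The energy dissipates only `F²`;
the cross term supplies `-ε G²`, and its other contributions are absorbed because `7ν/8 - 3ν/8 =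
ν/2`. -/
theorem lyapunov_deriv_le {D ν ε F G a : ℝ} (hν : 0 < ν) (hε0 : 0 < ε)
    (hεq : ε * ((ν + a) ^ 2 / 2 + a) ≤ 3 * ν / 8) (hF : -(ν / 8) ≤ F) (hFa : F ≤ a)
    (hNa : 1 - D * G ≤ a) :
    -(ν + F) * F ^ 2 + ε * ((-F ^ 2 - ν * F - G) * G + F * (F * (1 - D * G))) ≤
      -(ν / 2 * F ^ 2 + ε / 2 * G ^ 2) := by
  have h2 : -((ν + F) * (F * G)) ≤ (ν + a) ^ 2 / 2 * F ^ 2 + G ^ 2 / 2 := by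
    have h3 : (ν + F) ^ 2 * F ^ 2 ≤ (ν + a) ^ 2 * F ^ 2 := by gcongr; linarith
    have h4 := sq_nonneg ((ν + F) * F + G)
    linarith
  have h4 : (1 - D * G) * F ^ 2 ≤ a * F ^ 2 := by gcongr
  have h5 : ε * (-((ν + F) * (F * G)) + (1 - D * G) * F ^ 2) ≤
      ε * (((ν + a) ^ 2 / 2 + a) * F ^ 2 + G ^ 2 / 2) :=
    mul_le_mul_of_nonneg_left (by linarith) hε0.le
  have h6 : ε * ((ν + a) ^ 2 / 2 + a) * F ^ 2 ≤ 3 * ν / 8 * F ^ 2 := by gcongr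
  have h7 : 7 * ν / 8 * F ^ 2 ≤ (ν + F) * F ^ 2 := by gcongr; linarith
  linarith

/-- Exponential decay, with some rate, along the characteristics. -/
theorem exists_exp_decay {D ν a B c : ℝ} (hD : 1 ≤ D) (hν : 0 < ν) (ha : 0 ≤ a)
    (hc : 0 < c) : ∃ K κ m, 0 ≤ K ∧ 0 < κ ∧ 0 < m ∧ ∀ F G : ℝ → ℝ,
      (∀ t, 0 ≤ t → HasDerivAt F (-F t ^ 2 - ν * F t - G t) t) →
      (∀ t, 0 ≤ t → HasDerivAt G (F t * (1 - D * G t)) t) →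
      (∀ t, 0 ≤ t → -(ν / 8) ≤ F t) → (∀ t, 0 ≤ t → F t ≤ a) →
      (∀ t, 0 ≤ t → 0 < 1 - D * G t) → (∀ t, 0 ≤ t → 1 - D * G t ≤ a) →
      |F 0| ≤ B → c ≤ 1 - D * G 0 →
      ∀ t, 0 ≤ t → |F t| + |G t| ≤ K * Real.exp (-κ * t) ∧ m ≤ 1 - D * G t := by
  have hD0 : 0 < D := by linarith
  -- A bound for the initial energy. Since the energy does not increase, `-1 - log N ≤ D² H₀`, which
  -- gives the lower bound `m` for `N`.
  set H₀ := B ^ 2 / 2 + (a - 1 - Real.log c) / D ^ 2 with hH₀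
  set m := Real.exp (-1 - D ^ 2 * H₀) with hm
  have hm0 : 0 < m := Real.exp_pos _
  set q := (ν + a) ^ 2 / 2 + a with hq
  have hq0 : 0 < q := by positivity
  set ε := min (3 * ν / (8 * q)) (1 / (2 * (a + 1))) with hε
  have hε0 : 0 < ε := by positivity
  have hεq : ε * q ≤ 3 * ν / 8 := by
    calc ε * q ≤ 3 * ν / (8 * q) * q := by gcongr; exact min_le_left _ _
      _ = _ := by field_simp
  have hεa : ε * (2 * (a + 1)) ≤ 1 := by
    calc ε * (2 * (a + 1)) ≤ 1 / (2 * (a + 1)) * (2 * (a + 1)) := by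
          gcongr; exact min_le_right _ _
      _ = _ := by field_simp
  set C := 1 + 1 / m with hC
  have hC0 : 0 < C := by positivity
  set κ := min (ν / 2) (ε / 2) / C with hκ
  have hκ0 : 0 < κ := by positivity
  have hκν : κ * C ≤ ν / 2 := by
    rw [hκ, div_mul_cancel₀ _ hC0.ne']; exact min_le_left _ _
  have hκε : κ * C ≤ ε / 2 := by
    rw [hκ, div_mul_cancel₀ _ hC0.ne']; exact min_le_right _ _
  set K := Real.sqrt (8 * (a + 1) * C * (B ^ 2 + (a + 1) ^ 2)) with hK
  refine ⟨K, κ / 2, m, by positivity, by positivity, hm0, ?_⟩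
  intro F G hF hG hF1 hF2 hN1 hN2 hF0 hN0
  -- The `FG` terms of the two summands cancel, leaving `H' = -(ν + F) F² ≤ 0`.
  set H : ℝ → ℝ := fun t => F t ^ 2 / 2 + (1 - D * G t - 1 - Real.log (1 - D * G t)) / D ^ 2 with hHd
  have dH (t : ℝ) (ht : 0 ≤ t) : HasDerivAt H (-(ν + F t) * F t ^ 2) t := by
    have hN := hN1 t ht
    have dN : HasDerivAt (fun t => 1 - D * G t) (-(D * (F t * (1 - D * G t)))) t :=
      ((hG t ht).const_mul D).const_sub 1
    refine ((((hF t ht).pow 2).div_const 2).add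
      (((dN.sub_const 1).sub (dN.log hN.ne')).div_const (D ^ 2))).congr_deriv ?_
    have hN' : -(D * (F t * (1 - D * G t))) / (1 - D * G t) = -(D * F t) := by
      rw [div_eq_iff hN.ne']; ring
    rw [hN']
    field_simp
    push_cast
    ring
  have hmin (t : ℝ) (ht : 0 ≤ t) : m ≤ 1 - D * G t := by
    have h1 := le_mul_exp_of_deriv_le (m := H) (Φ := fun _ => 0) dH
      (fun t _ => hasDerivAt_const t 0) (fun t ht => by
        have := hF1 t ht
        rw [zero_mul]
        nlinarith [sq_nonneg (F t)]) t ht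
    simp only [sub_self, Real.exp_zero, mul_one] at h1
    have h2 : H 0 ≤ H₀ := by
      simp only [hHd, hH₀]
      have := Real.log_le_log hc hN0
      have := hN2 0 le_rfl
      have : F 0 ^ 2 ≤ B ^ 2 := sq_le_sq' (abs_le.1 hF0).1 (abs_le.1 hF0).2
      gcongr
    have h3 : (1 - D * G t - 1 - Real.log (1 - D * G t)) / D ^ 2 ≤ H₀ := by
      have : 0 ≤ F t ^ 2 / 2 := by positivity
      have h4 : H t ≤ H₀ := h1.trans h2
      simp only [hHd] at h4
      linarith
    rw [div_le_iff₀ (by positivity)] at h3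
    rw [hm, ← Real.le_log_iff_exp_le (hN1 t ht)]
    have := hN1 t ht
    linarith
  set W : ℝ → ℝ := fun t => H t + ε * (F t * G t) with hW
  have dW (t : ℝ) (ht : 0 ≤ t) : HasDerivAt W (-(ν + F t) * F t ^ 2 +
      ε * ((-F t ^ 2 - ν * F t - G t) * G t + F t * (F t * (1 - D * G t)))) t :=
    (dH t ht).add (((hF t ht).mul (hG t ht)).const_mul ε)
  have hWle (t : ℝ) (ht : 0 ≤ t) : W t ≤ C * (F t ^ 2 + G t ^ 2) :=
    lyapunov_le hD ha hm0 hε0 hεa (hmin t ht)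
  have hleW (t : ℝ) (ht : 0 ≤ t) : (F t ^ 2 + G t ^ 2) / (4 * (a + 1)) ≤ W t :=
    le_lyapunov hD ha hε0 hεa (hN1 t ht) (hN2 t ht)
  have hdec (t : ℝ) (ht : 0 ≤ t) := le_mul_exp_of_deriv_le (m := W) (Φ := fun t => -κ * t)
    (Φ' := fun _ => -κ) dW (fun t _ => by simpa using (hasDerivAt_id t).const_mul (-κ))
    (fun t ht => by
      have h1 : κ * W t ≤ ν / 2 * F t ^ 2 + ε / 2 * G t ^ 2 := by
        calc κ * W t ≤ κ * (C * (F t ^ 2 + G t ^ 2)) := by gcongr; exact hWle t ht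
          _ = (κ * C) * F t ^ 2 + (κ * C) * G t ^ 2 := by ring
          _ ≤ _ := by gcongr
      have h2 := lyapunov_deriv_le hν hε0 hεq (hF1 t ht) (hF2 t ht) (hN2 t ht)
      linarith) t ht
  intro t ht
  refine ⟨?_, hmin t ht⟩
  have hF0' : F 0 ^ 2 ≤ B ^ 2 := sq_le_sq' (abs_le.1 hF0).1 (abs_le.1 hF0).2
  have hG0' : G 0 ^ 2 ≤ (a + 1) ^ 2 := by
    have h1 := hN1 0 le_rfl
    have h2 := hN2 0 le_rfl
    refine sq_le_sq' ?_ ?_ <;> nlinarith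
  have hfin : F t ^ 2 + G t ^ 2 ≤
      4 * (a + 1) * (C * (B ^ 2 + (a + 1) ^ 2) * Real.exp (-κ * t)) := by
    have h1 := hdec t ht
    simp only [mul_zero, sub_zero] at h1
    have h2 := hleW t ht
    rw [div_le_iff₀ (by positivity)] at h2
    have h3 : W 0 ≤ C * (B ^ 2 + (a + 1) ^ 2) := (hWle 0 le_rfl).trans (by gcongr)
    calc _ ≤ W t * (4 * (a + 1)) := h2
      _ ≤ (C * (B ^ 2 + (a + 1) ^ 2) * Real.exp (-κ * t)) * (4 * (a + 1)) := by
        gcongr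
        exact h1.trans (by gcongr)
      _ = _ := by ring
  refine abs_le_of_sq_le_sq' ?_ (by positivity) |>.2
  have h7 : (K * Real.exp (-(κ / 2) * t)) ^ 2 =
      8 * (a + 1) * C * (B ^ 2 + (a + 1) ^ 2) * Real.exp (-κ * t) := by
    rw [mul_pow, hK, Real.sq_sqrt (by positivity), ← Real.exp_nat_mul]
    congr 2
    push_cast
    ring
  rw [h7]
  have h8 : (|F t| + |G t|) ^ 2 ≤ 2 * (F t ^ 2 + G t ^ 2) := by
    rw [← sq_abs (F t), ← sq_abs (G t)]
    nlinarith [sq_nonneg (|F t| - |G t|)]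
  linarith

end Decay

theorem abs_mul_add_mul_le {x y p s k l : ℝ} (hx : |x| ≤ k * l) (hy : |y| ≤ k * l) :
    |x * p + y * s| ≤ k * l * (|p| + |s|) := by
  calc _ ≤ |x| * |p| + |y| * |s| := by
        rw [← abs_mul, ← abs_mul]; exact abs_add_le _ _
    _ ≤ (k * l) * |p| + (k * l) * |s| := by gcongr
    _ = _ := by ring

/-- If `n₀` and the mean density `1 - D G₀` are bounded below, the solution and its derivatives
decay at the sharp rate, uniformly over the characteristics. -/
theorem IsCharFamily.exists_decay {D ν A B c a b : ℝ} {F₀ G₀ : ℝ → ℝ} {F G l Fρ Gρ lρ : ℝ → ℝ → ℝ}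
    (h : IsCharFamily D ν A B F₀ G₀ F G l Fρ Gρ lρ) (hD : 1 ≤ D) (hA : 1 ≤ A) (hB : 0 ≤ B)
    (hc : 0 < c) (ha : 0 < a) (hab : a < b) (hab1 : a * b = 1) (habν : a + b = ν)
    (hF₀ : ∀ ρ, 0 ≤ ρ → |F₀ ρ| ≤ B) (hG₀ : ∀ ρ, 0 ≤ ρ → |G₀ ρ| ≤ B)
    (hρF₀ : ∀ ρ, 0 ≤ ρ → |ρ * F₀ ρ| ≤ B) (hρG₀ : ∀ ρ, 0 ≤ ρ → |ρ * G₀ ρ| ≤ B)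
    (hF₀' : ∀ ρ, 0 ≤ ρ → |ρ * deriv F₀ ρ| ≤ B) (hG₀' : ∀ ρ, 0 ≤ ρ → |ρ * deriv G₀ ρ| ≤ B)
    (hN₀ : ∀ ρ, 0 ≤ ρ → c ≤ 1 - D * G₀ ρ) (hN₀A : ∀ ρ, 0 ≤ ρ → 1 - D * G₀ ρ ≤ A)
    (hn₀ : ∀ ρ, 0 ≤ ρ → c ≤ 1 - D * G₀ ρ - ρ * deriv G₀ ρ) :
    ∃ C, 0 < C ∧ ∀ t ρ, 0 ≤ t → 0 ≤ ρ →
      |F t ρ| ≤ C * Real.exp (-(a * t)) ∧ |G t ρ| ≤ C * Real.exp (-(a * t)) ∧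
      |ρ * Real.exp (l t ρ) * F t ρ| ≤ C * Real.exp (-(a * t)) ∧
      |ρ * Real.exp (l t ρ) * G t ρ| ≤ C * Real.exp (-(a * t)) ∧
      |F t ρ + ρ * Fρ t ρ / (1 + ρ * lρ t ρ)| ≤ C * Real.exp (-(a * t)) ∧
      |G t ρ + ρ * Gρ t ρ / (1 + ρ * lρ t ρ)| ≤ C * Real.exp (-(a * t)) := by
  have hν : 0 < ν := by linarith
  obtain ⟨K, κ, m, hK, hκ, hm, hdec⟩ := exists_exp_decay (D := D) (ν := ν) (a := B + 2 * A + 2)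
    (B := B) (c := c) hD hν (by linarith) hc
  have hd (t ρ : ℝ) (ht : 0 ≤ t) (hρ : 0 ≤ ρ) := hdec (fun t => F t ρ) (fun t => G t ρ)
    (fun t ht => h.hasDerivAt_F t ρ ht hρ) (fun t ht => h.hasDerivAt_G t ρ ht hρ)
    (fun t ht => (h.lt_F t ρ ht hρ).le) (fun t ht => (h.F_lt t ρ ht hρ).le)
    (fun t ht => h.N_pos t ρ ht hρ) (fun t ht => (h.N_lt t ρ ht hρ).le.trans (by linarith))
    (by simpa only [h.F_zero] using hF₀ ρ hρ) (by simpa only [h.G_zero] using hN₀ ρ hρ) t ht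
  -- Every perturbation coefficient below is `F` or `G` times a number of size at most `3D`.
  obtain ⟨C, hC, hper⟩ := exists_decay_of_perturbation (K := 3 * D * K) ha hab hab1
    (by positivity) hκ
  have hsmall (t ρ k : ℝ) (ht : 0 ≤ t) (hρ : 0 ≤ ρ) (hk : |k| ≤ 3 * D) :
      |k * F t ρ| ≤ 3 * D * K * Real.exp (-κ * t) ∧
        |k * G t ρ| ≤ 3 * D * K * Real.exp (-κ * t) := by
    have h1 := (hd t ρ ht hρ).1
    rw [abs_mul, abs_mul, mul_assoc (3 * D)]
    constructor
    · gcongr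
      linarith [abs_nonneg (G t ρ)]
    · gcongr
      linarith [abs_nonneg (F t ρ)]
  have h0 (t : ℝ) : |(0 : ℝ)| ≤ 3 * D * K * Real.exp (-κ * t) := by
    rw [abs_zero]; positivity
  have hFG (t ρ : ℝ) (ht : 0 ≤ t) (hρ : 0 ≤ ρ) :
      |F t ρ| + |G t ρ| ≤ C * (2 * B) * Real.exp (-(a * t)) := by
    refine (hper (fun t => F t ρ) (fun t => G t ρ) (fun t => -F t ρ * F t ρ + 0 * G t ρ)
      (fun t => 0 * F t ρ + -D * F t ρ * G t ρ) (fun t ht => ?_) (fun t ht => ?_) (fun t ht => ?_)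
      (fun t ht => ?_) t ht).trans ?_
    · refine (h.hasDerivAt_F t ρ ht hρ).congr_deriv ?_
      rw [habν]; ring
    · refine (h.hasDerivAt_G t ρ ht hρ).congr_deriv ?_
      ring
    · refine abs_mul_add_mul_le ?_ (h0 t)
      have := (hsmall t ρ (-1) ht hρ (by norm_num; linarith)).1
      rwa [neg_one_mul] at this
    · exact abs_mul_add_mul_le (h0 t) (hsmall t ρ (-D) ht hρ
        (by rw [abs_neg, abs_of_pos (by linarith)]; linarith)).1
    · simp only [h.F_zero, h.G_zero]
      gcongr
      linarith [hF₀ ρ hρ, hG₀ ρ hρ]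
  -- For the values of the fields, `p = rF` and `s = rG`, the momentum equation is exactly linear:
  -- transport cancels `F²`.
  have hvg (t ρ : ℝ) (ht : 0 ≤ t) (hρ : 0 ≤ ρ) :
      |ρ * Real.exp (l t ρ) * F t ρ| + |ρ * Real.exp (l t ρ) * G t ρ| ≤
        C * (2 * B) * Real.exp (-(a * t)) := by
    have hq (t : ℝ) (ht : 0 ≤ t) : HasDerivAt (fun t => ρ * Real.exp (l t ρ))
        (ρ * (Real.exp (l t ρ) * F t ρ)) t := (h.hasDerivAt_l t ρ ht hρ).exp.const_mul ρ
    refine (hper (fun t => ρ * Real.exp (l t ρ) * F t ρ) (fun t => ρ * Real.exp (l t ρ) * G t ρ)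
      (fun t => 0) (fun t => (1 - D) * G t ρ * (ρ * Real.exp (l t ρ) * F t ρ) +
        0 * (ρ * Real.exp (l t ρ) * G t ρ)) (fun t ht => ?_) (fun t ht => ?_) (fun t ht => ?_)
      (fun t ht => ?_) t ht).trans ?_
    · refine ((hq t ht).mul (h.hasDerivAt_F t ρ ht hρ)).congr_deriv ?_
      rw [habν]; ring
    · refine ((hq t ht).mul (h.hasDerivAt_G t ρ ht hρ)).congr_deriv ?_
      ring
    · rw [abs_zero]; positivity
    · exact abs_mul_add_mul_le (hsmall t ρ (1 - D) ht hρ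
        (by rw [abs_le]; constructor <;> linarith)).2 (h0 t)
    · simp only [h.F_zero, h.G_zero, h.l_zero, Real.exp_zero, mul_one]
      gcongr
      linarith [hρF₀ ρ hρ, hρG₀ ρ hρ]
  have hρ' (t ρ : ℝ) (ht : 0 ≤ t) (hρ : 0 ≤ ρ) :
      |ρ * Fρ t ρ| + |ρ * Gρ t ρ| ≤ C * (2 * B) * Real.exp (-(a * t)) := by
    refine (hper (fun t => ρ * Fρ t ρ) (fun t => ρ * Gρ t ρ)
      (fun t => -2 * F t ρ * (ρ * Fρ t ρ) + 0 * (ρ * Gρ t ρ))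
      (fun t => -D * G t ρ * (ρ * Fρ t ρ) + -D * F t ρ * (ρ * Gρ t ρ))
      (fun t ht => ?_) (fun t ht => ?_) (fun t ht => ?_)
      (fun t ht => ?_) t ht).trans ?_
    · refine ((h.hasDerivAt_Fρ t ρ ht hρ).const_mul ρ).congr_deriv ?_
      rw [habν]; ring
    · refine ((h.hasDerivAt_Gρ t ρ ht hρ).const_mul ρ).congr_deriv ?_
      ring
    · exact abs_mul_add_mul_le (hsmall t ρ (-2) ht hρ (by norm_num; linarith)).1 (h0 t)
    · have := hsmall t ρ (-D) ht hρ (by rw [abs_neg, abs_of_pos (by linarith)]; linarith)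
      exact abs_mul_add_mul_le this.2 this.1
    · simp only [h.Fρ_zero, h.Gρ_zero]
      gcongr
      linarith [hF₀' ρ hρ, hG₀' ρ hρ]
  -- After `T`, `|ρ Gρ|` is so small that `x = κ + ρ Gρ / N` keeps at least half of `c / A ≤ κ`.
  -- Before `T` the bound of `jacobian_pos` suffices.
  obtain ⟨T, hT0, hT⟩ : ∃ T : ℝ, 0 ≤ T ∧ C * (2 * B) * Real.exp (-(a * T)) ≤ m * (c / (2 * A)) := by
    have hlim : Tendsto (fun T : ℝ => C * (2 * B) * Real.exp (-(a * T))) atTop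
        (𝓝 (C * (2 * B) * 0)) :=
      (Real.tendsto_exp_neg_atTop_nhds_zero.comp
        (tendsto_id.const_mul_atTop ha)).const_mul _
    rw [mul_zero] at hlim
    obtain ⟨T, h1, h2⟩ := ((hlim.eventually (ge_mem_nhds (show 0 < m * (c / (2 * A)) by
      positivity))).and (eventually_ge_atTop 0)).exists
    exact ⟨T, h2, h1⟩
  set x₀ := min (c / (2 * A)) (Real.exp (-(ν / 2) * T) / 2) with hx₀
  have hx₀pos : 0 < x₀ := by positivity
  have hx (t ρ : ℝ) (ht : 0 ≤ t) (hρ : 0 ≤ ρ) : x₀ ≤ 1 + ρ * lρ t ρ := by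
    rcases le_total t T with htT | htT
    · refine (min_le_right _ _).trans (le_trans ?_ (h.lt_jacobian t ρ ht hρ).le)
      have : -(ν / 2) * T ≤ -(ν / 2) * t := by nlinarith
      gcongr
    · refine (min_le_left _ _).trans ?_
      have hN₀pos : 0 < 1 - D * G₀ ρ := hc.trans_le (hN₀ ρ hρ)
      have hNm := (hd t ρ ht hρ).2
      have hNpos := h.N_pos t ρ ht hρ
      have h1 : c / A ≤ (1 - D * G₀ ρ - ρ * deriv G₀ ρ) / (1 - D * G₀ ρ) :=
        div_le_div₀ (hc.le.trans (hn₀ ρ hρ)) (hn₀ ρ hρ) hN₀pos (hN₀A ρ hρ)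
      have h2 : |ρ * Gρ t ρ| ≤ m * (c / (2 * A)) := by
        refine le_trans ?_ hT
        have := hρ' t ρ ht hρ
        refine (by linarith [abs_nonneg (ρ * Fρ t ρ)] :
          |ρ * Gρ t ρ| ≤ C * (2 * B) * Real.exp (-(a * t))).trans ?_
        gcongr
      have h3 : -(c / (2 * A)) ≤ 1 + ρ * lρ t ρ -
          (1 - D * G₀ ρ - ρ * deriv G₀ ρ) / (1 - D * G₀ ρ) := by
        have h4 := h.Gρ_eq t ρ ht hρ
        have h5 : -((1 - D * G t ρ) * (c / (2 * A))) ≤ ρ * Gρ t ρ := by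
          have : m * (c / (2 * A)) ≤ (1 - D * G t ρ) * (c / (2 * A)) := by gcongr
          linarith [neg_abs_le (ρ * Gρ t ρ)]
        rw [h4, ← mul_neg] at h5
        exact le_of_mul_le_mul_left h5 hNpos
      have h6 : c / A = c / (2 * A) + c / (2 * A) := by field_simp; ring
      linarith
  refine ⟨C * (2 * B) + C * (2 * B) / x₀ + 1, by positivity, fun t ρ ht hρ => ?_⟩
  have hE : 0 < Real.exp (-(a * t)) := Real.exp_pos _
  have e1 : C * (2 * B) * Real.exp (-(a * t)) ≤
      (C * (2 * B) + C * (2 * B) / x₀ + 1) * Real.exp (-(a * t)) := by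
    gcongr
    rw [add_assoc]
    exact le_add_of_nonneg_right (by positivity)
  have e2 (p q : ℝ) (hp : |p| ≤ C * (2 * B) * Real.exp (-(a * t)))
      (hq : |q| ≤ C * (2 * B) * Real.exp (-(a * t))) : |p + q / (1 + ρ * lρ t ρ)| ≤
      (C * (2 * B) + C * (2 * B) / x₀ + 1) * Real.exp (-(a * t)) := by
    have hxt := hx t ρ ht hρ
    calc _ ≤ |p| + |q| / (1 + ρ * lρ t ρ) := by
          refine (abs_add_le _ _).trans ?_
          rw [abs_div, abs_of_pos (hx₀pos.trans_le hxt)]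
      _ ≤ C * (2 * B) * Real.exp (-(a * t)) + C * (2 * B) * Real.exp (-(a * t)) / x₀ := by
          gcongr
      _ ≤ _ := by
          have : C * (2 * B) * Real.exp (-(a * t)) / x₀ =
            C * (2 * B) / x₀ * Real.exp (-(a * t)) := by ring
          rw [this]
          linarith
  have i1 := hFG t ρ ht hρ
  have i2 := hvg t ρ ht hρ
  have i3 := hρ' t ρ ht hρ
  have n1 := abs_nonneg (F t ρ)
  have n2 := abs_nonneg (G t ρ)
  have n3 := abs_nonneg (ρ * Real.exp (l t ρ) * F t ρ)
  have n4 := abs_nonneg (ρ * Real.exp (l t ρ) * G t ρ)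
  have n5 := abs_nonneg (ρ * Fρ t ρ)
  have n6 := abs_nonneg (ρ * Gρ t ρ)
  exact ⟨by linarith, by linarith, by linarith, by linarith, e2 _ _ (by linarith) (by linarith),
    e2 _ _ (by linarith) (by linarith)⟩

/-! ### Calculus of radial vector fields -/

section Radial

variable {d : ℕ}

/-- The rank one map `w ↦ ⟪x, w⟫ x / |x|`, which is zero for `x = 0`. -/
noncomputable def radialMap (x : Space d) : Space d →L[ℝ] Space d :=
  (‖x‖⁻¹ • innerSL ℝ x).smulRight x

theorem radialMap_apply (x w : Space d) : radialMap x w = (‖x‖⁻¹ * inner ℝ x w) • x := by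
  simp [radialMap]

theorem radialMap_zero : radialMap (0 : Space d) = 0 := by
  ext w; simp [radialMap_apply]

theorem norm_radialMap_le (x : Space d) : ‖radialMap x‖ ≤ ‖x‖ := by
  refine ContinuousLinearMap.opNorm_le_bound _ (norm_nonneg _) fun w => ?_
  rcases eq_or_ne x 0 with rfl | hx
  · simp [radialMap_zero]
  have hx' : 0 < ‖x‖ := norm_pos_iff.2 hx
  rw [radialMap_apply, norm_smul, norm_mul, norm_inv, norm_norm]
  have := norm_inner_le_norm (𝕜 := ℝ) x w
  calc ‖x‖⁻¹ * ‖inner ℝ x w‖ * ‖x‖ ≤ ‖x‖⁻¹ * (‖x‖ * ‖w‖) * ‖x‖ := by gcongr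
    _ = _ := by field_simp

theorem continuous_radialMap : Continuous (radialMap (d := d)) := by
  rw [continuous_iff_continuousAt]
  intro x
  rcases eq_or_ne x 0 with rfl | hx
  · rw [ContinuousAt, radialMap_zero, tendsto_zero_iff_norm_tendsto_zero]
    refine squeeze_zero (fun _ => norm_nonneg _) norm_radialMap_le ?_
    simpa using (continuous_norm (E := Space d)).tendsto 0
  · have h1 : ContinuousAt (fun y : Space d => ‖y‖⁻¹ • innerSL ℝ y) x :=
      (continuousAt_id.norm.inv₀ (norm_ne_zero_iff.2 hx)).smul (innerSL ℝ).continuous.continuousAt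
    have h2 : Continuous fun p : (Space d →L[ℝ] ℝ) × Space d => p.1.smulRight p.2 := by fun_prop
    exact h2.continuousAt.comp (f := fun y : Space d => (‖y‖⁻¹ • innerSL ℝ y, y))
      (h1.prodMk continuousAt_id)

theorem hasFDerivAt_norm_of_ne {x : Space d} (hx : x ≠ 0) :
    HasFDerivAt (fun y : Space d => ‖y‖) (‖x‖⁻¹ • innerSL ℝ x) x := by
  have h := ((hasStrictFDerivAt_norm_sq x).hasFDerivAt).sqrt
    (pow_ne_zero 2 (norm_ne_zero_iff.2 hx))
  simp only [Real.sqrt_sq (norm_nonneg _)] at h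
  refine h.congr_fderiv ?_
  ext w
  simp
  ring

/-- The derivative of `(t, x) ↦ ψ (t, |x|) x`. -/
noncomputable def radialFDeriv (ψ : ℝ × ℝ → ℝ) (p : ℝ × Space d) : ℝ × Space d →L[ℝ] Space d :=
  ψ (p.1, ‖p.2‖) • ContinuousLinearMap.snd ℝ ℝ (Space d) +
    (fderiv ℝ ψ (p.1, ‖p.2‖) (1, 0)) • (ContinuousLinearMap.fst ℝ ℝ (Space d)).smulRight p.2 +
    (fderiv ℝ ψ (p.1, ‖p.2‖) (0, 1)) •
      (radialMap p.2).comp (ContinuousLinearMap.snd ℝ ℝ (Space d))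

theorem radialFDeriv_apply (ψ : ℝ × ℝ → ℝ) (p : ℝ × Space d) (τ : ℝ) (w : Space d) :
    radialFDeriv ψ p (τ, w) = ψ (p.1, ‖p.2‖) • w + (fderiv ℝ ψ (p.1, ‖p.2‖) (1, 0) * τ) • p.2 +
      (fderiv ℝ ψ (p.1, ‖p.2‖) (0, 1)) • radialMap p.2 w := by
  simp [radialFDeriv, smul_smul]

theorem hasFDerivAt_radial {ψ : ℝ × ℝ → ℝ} (hψ : ContDiff ℝ 1 ψ) (p : ℝ × Space d) :
    HasFDerivAt (fun p : ℝ × Space d => ψ (p.1, ‖p.2‖) • p.2) (radialFDeriv ψ p) p := by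
  obtain ⟨t, x⟩ := p
  rcases eq_or_ne x 0 with rfl | hx
  -- The norm is not differentiable at the origin, but the factor `p.2` vanishes there: continuity
  -- of `ψ` gives `o(1) * O(|p - (t, 0)|)`.
  · rw [hasFDerivAt_iff_isLittleO]
    have hc : ContinuousAt (fun p : ℝ × Space d => ψ (p.1, ‖p.2‖) - ψ (t, 0)) (t, 0) := by
      have := hψ.continuous
      fun_prop
    have h1 : (fun p : ℝ × Space d => ψ (p.1, ‖p.2‖) - ψ (t, 0)) =o[𝓝 (t, 0)]
        fun _ => (1 : ℝ) := by
      rw [Asymptotics.isLittleO_one_iff]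
      simpa [ContinuousAt] using hc
    have h2 : (fun p : ℝ × Space d => p.2) =O[𝓝 (t, 0)] fun p => p - (t, (0 : Space d)) := by
      refine Asymptotics.IsBigO.of_bound 1 (Eventually.of_forall fun p => ?_)
      have := norm_snd_le (p - (t, (0 : Space d)))
      simpa using this
    have h3 := h1.smul_isBigO h2
    simp only [one_smul] at h3
    refine h3.congr_left fun p => ?_
    have e : p - (t, (0 : Space d)) = (p.1 - t, p.2) := by ext <;> simp
    rw [e, radialFDeriv_apply]
    simp [radialMap_zero, sub_smul]
  · have h1 : HasFDerivAt (fun p : ℝ × Space d => (p.1, ‖p.2‖))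
        ((ContinuousLinearMap.fst ℝ ℝ (Space d)).prod
          ((‖x‖⁻¹ • innerSL ℝ x).comp (ContinuousLinearMap.snd ℝ ℝ (Space d)))) (t, x) := by
      refine hasFDerivAt_fst.prodMk ?_
      exact HasFDerivAt.comp (g := fun y : Space d => ‖y‖) (t, x) (hasFDerivAt_norm_of_ne hx)
        hasFDerivAt_snd
    have h2 : HasFDerivAt (fun p : ℝ × Space d => ψ (p.1, ‖p.2‖)) _ (t, x) :=
      HasFDerivAt.comp (g := ψ) (t, x)
        ((hψ.differentiable one_ne_zero (t, ‖x‖)).hasFDerivAt) h1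
    refine (h2.smul hasFDerivAt_snd).congr_fderiv ?_
    refine ContinuousLinearMap.ext fun ⟨τ, w⟩ => ?_
    have e (r : ℝ) : fderiv ℝ ψ (t, ‖x‖) (τ, r) =
        fderiv ℝ ψ (t, ‖x‖) (1, 0) * τ + fderiv ℝ ψ (t, ‖x‖) (0, 1) * r := by
      have : ((τ, r) : ℝ × ℝ) = τ • (1, 0) + r • (0, 1) := by ext <;> simp
      rw [this, map_add, map_smul, map_smul]
      simp only [smul_eq_mul]
      ring
    rw [radialFDeriv_apply, radialMap_apply]
    simp only [add_apply, smul_apply,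
      ContinuousLinearMap.coe_snd', ContinuousLinearMap.smulRight_apply,
      ContinuousLinearMap.comp_apply, ContinuousLinearMap.prod_apply,
      ContinuousLinearMap.coe_fst', e, innerSL_apply_apply, smul_eq_mul]
    module

theorem contDiff_radial {ψ : ℝ × ℝ → ℝ} (hψ : ContDiff ℝ 1 ψ) :
    ContDiff ℝ 1 fun p : ℝ × Space d => ψ (p.1, ‖p.2‖) • p.2 := by
  rw [contDiff_one_iff_hasFDerivAt]
  refine ⟨radialFDeriv ψ, ?_, hasFDerivAt_radial hψ⟩
  have h1 : Continuous (fderiv ℝ ψ) := hψ.continuous_fderiv one_ne_zero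
  have h0 : Continuous ψ := hψ.continuous
  have hn : Continuous fun p : ℝ × Space d => (p.1, ‖p.2‖) := by fun_prop
  have h2 (v : ℝ × ℝ) : Continuous fun p : ℝ × Space d => fderiv ℝ ψ (p.1, ‖p.2‖) v :=
    (h1.comp hn).clm_apply continuous_const
  have h3 : Continuous fun p : ℝ × Space d =>
      (radialMap p.2).comp (ContinuousLinearMap.snd ℝ ℝ (Space d)) :=
    (continuous_radialMap.comp continuous_snd).clm_comp continuous_const
  have h4 : Continuous fun p : ℝ × Space d =>
      (ContinuousLinearMap.fst ℝ ℝ (Space d)).smulRight p.2 := by fun_prop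
  exact (((h0.comp hn).smul continuous_const).add ((h2 _).smul h4)).add ((h2 _).smul h3)

theorem hasFDerivAt_radialField_of_ne {g : ℝ → ℝ} {g' : ℝ} {x : Space d} (hx : x ≠ 0)
    (hg : HasDerivAt g g' ‖x‖) :
    HasFDerivAt (radialField d g) (g ‖x‖ • ContinuousLinearMap.id ℝ (Space d) + g' • radialMap x)
      x := by
  have h1 : HasFDerivAt (fun y : Space d => g ‖y‖) _ x :=
    hg.comp_hasFDerivAt x (hasFDerivAt_norm_of_ne hx)
  refine (h1.smul (hasFDerivAt_id x)).congr_fderiv ?_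
  ext1 w
  simp only [id, add_apply, smul_apply,
    ContinuousLinearMap.smulRight_apply, radialMap_apply, innerSL_apply_apply, smul_eq_mul,
    ContinuousLinearMap.id_apply]
  module

theorem hasFDerivAt_radialField {g : ℝ → ℝ} (hg : ContDiff ℝ 1 g) (x : Space d) :
    HasFDerivAt (radialField d g)
      (g ‖x‖ • ContinuousLinearMap.id ℝ (Space d) + deriv g ‖x‖ • radialMap x) x := by
  have hgd (r : ℝ) : HasDerivAt g (deriv g r) r := (hg.differentiable one_ne_zero r).hasDerivAt
  rcases eq_or_ne x 0 with rfl | hx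
  · have h := hasFDerivAt_radial (d := d) (ψ := fun p => g p.2) (hg.comp contDiff_snd)
      ((0 : ℝ), (0 : Space d))
    have h2 : HasFDerivAt (fun y : Space d => ((0 : ℝ), y))
        ((0 : Space d →L[ℝ] ℝ).prod (ContinuousLinearMap.id ℝ (Space d))) 0 :=
      (hasFDerivAt_const (0 : ℝ) (0 : Space d)).prodMk (hasFDerivAt_id (0 : Space d))
    have h3 : HasFDerivAt (radialField d g) _ 0 := HasFDerivAt.comp
      (g := fun p : ℝ × Space d => g ‖p.2‖ • p.2) (f := fun y : Space d => ((0 : ℝ), y)) 0 h h2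
    refine h3.congr_fderiv ?_
    ext1 w
    have e : ((0 : Space d →L[ℝ] ℝ).prod (ContinuousLinearMap.id ℝ (Space d))) w = (0, w) := rfl
    rw [ContinuousLinearMap.comp_apply, e, radialFDeriv_apply]
    simp [radialMap_zero]
  · exact hasFDerivAt_radialField_of_ne hx (hgd _)

/-- The profile of a differentiable radial field is differentiable away from the origin. -/
theorem exists_hasDerivAt_of_radialField {g : ℝ → ℝ} {x : Space d} (hx : x ≠ 0)
    (h : DifferentiableAt ℝ (radialField d g) x) : ∃ g', HasDerivAt g g' ‖x‖ := by
  have hx' : 0 < ‖x‖ := norm_pos_iff.2 hx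
  have hx1 := hx'.ne'
  -- Along the ray through `x`, the inner product with `x` recovers the profile.
  have hcurve : HasDerivAt (fun s : ℝ => (s * ‖x‖⁻¹) • x) ((1 * ‖x‖⁻¹) • x) ‖x‖ :=
    ((hasDerivAt_id ‖x‖).mul_const _).smul_const x
  have hpt : (‖x‖ * ‖x‖⁻¹) • x = x := by rw [mul_inv_cancel₀ hx1, one_smul]
  have hW₀ : HasFDerivAt (radialField d g) (fderiv ℝ (radialField d g) x)
      ((fun s : ℝ => (s * ‖x‖⁻¹) • x) ‖x‖) := by
    simp only [hpt]; exact h.hasFDerivAt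
  have hW := hW₀.comp_hasDerivAt ‖x‖ hcurve
  have hI := (hW.inner ℝ (hasDerivAt_const ‖x‖ x)).div
    ((hasDerivAt_id ‖x‖).mul_const ‖x‖) (by simpa using hx1)
  refine ⟨_, hI.congr_of_eventuallyEq ?_⟩
  filter_upwards [lt_mem_nhds hx'] with s hs
  have hn : ‖(s * ‖x‖⁻¹) • x‖ = s := by
    rw [norm_smul, Real.norm_of_nonneg (by positivity)]; field_simp
  simp only [Function.comp_apply, radialField, hn, Pi.div_apply, real_inner_smul_left, real_inner_self_eq_norm_sq, id]
  field_simp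

theorem divergence_of_hasFDerivAt {W : Space d → Space d} {x : Space d} {p q : ℝ}
    (h : HasFDerivAt W (p • ContinuousLinearMap.id ℝ (Space d) + q • radialMap x) x) :
    divergence W x = d * p + q * ‖x‖ := by
  rw [divergence, h.fderiv]
  have (i : Fin d) : ((p • ContinuousLinearMap.id ℝ (Space d) + q • radialMap x)
      (EuclideanSpace.single i 1)) i = p + q * ‖x‖⁻¹ * (x i) ^ 2 := by
    simp [radialMap_apply, EuclideanSpace.inner_single_right]
    ring
  simp only [this]
  rw [Finset.sum_add_distrib, ← Finset.mul_sum, ← EuclideanSpace.real_norm_sq_eq]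
  simp only [Finset.sum_const, Finset.card_univ, Fintype.card_fin, nsmul_eq_mul]
  rcases eq_or_ne ‖x‖ 0 with h0 | h0
  · simp [h0]
  · field_simp

theorem divergence_radialField {g : ℝ → ℝ} (hg : ContDiff ℝ 1 g) (x : Space d) :
    divergence (radialField d g) x = d * g ‖x‖ + ‖x‖ * deriv g ‖x‖ := by
  rw [divergence_of_hasFDerivAt (hasFDerivAt_radialField hg x), mul_comm ‖x‖]

theorem radialMap_self (x : Space d) : radialMap x x = ‖x‖ • x := by
  rw [radialMap_apply, real_inner_self_eq_norm_sq]
  rcases eq_or_ne ‖x‖ 0 with h0 | h0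
  · simp [h0]
  · congr 1; field_simp

/-- For a radial field `W = g(|x|) x`, `DW(x) x = (div W) x - (d - 1) g(|x|) x`. -/
theorem fderiv_radialField_self {g : ℝ → ℝ} {x : Space d}
    (h : DifferentiableAt ℝ (radialField d g) x) :
    fderiv ℝ (radialField d g) x x =
      divergence (radialField d g) x • x - ((d - 1) * g ‖x‖) • x := by
  rcases eq_or_ne x 0 with rfl | hx
  · simp
  obtain ⟨g', hg'⟩ := exists_hasDerivAt_of_radialField hx h
  have hW := hasFDerivAt_radialField_of_ne hx hg'
  rw [divergence_of_hasFDerivAt hW, hW.fderiv]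
  simp only [add_apply, smul_apply,
    ContinuousLinearMap.id_apply, radialMap_self]
  module

/-- The derivative acts as `g` on directions orthogonal to `x` and as `u = g + g' |x|` along `x`.
Bounds on both give `|g'| |x| ≤ 2C`. -/
theorem norm_fderiv_radialField_le {g : ℝ → ℝ} {x : Space d} {C : ℝ} (hx : x ≠ 0)
    (h : DifferentiableAt ℝ (radialField d g) x) (hC : |g ‖x‖| ≤ C) {u : ℝ}
    (hu : fderiv ℝ (radialField d g) x x = u • x) (huC : |u| ≤ C) :
    ‖fderiv ℝ (radialField d g) x‖ ≤ 3 * C := by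
  obtain ⟨g', hg'⟩ := exists_hasDerivAt_of_radialField hx h
  have hW := hasFDerivAt_radialField_of_ne hx hg'
  have hxu : g ‖x‖ + g' * ‖x‖ = u := by
    rw [hW.fderiv] at hu
    simp only [add_apply, smul_apply,
      ContinuousLinearMap.id_apply, radialMap_self, smul_smul, ← add_smul] at hu
    exact smul_left_injective ℝ hx hu
  rw [hW.fderiv]
  calc _ ≤ ‖g ‖x‖ • ContinuousLinearMap.id ℝ (Space d)‖ + ‖g' • radialMap x‖ := norm_add_le _ _
    _ ≤ |g ‖x‖| * 1 + |g'| * ‖x‖ := by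
        rw [norm_smul, norm_smul]
        gcongr
        · exact le_rfl
        · exact ContinuousLinearMap.norm_id_le
        · exact le_rfl
        · exact norm_radialMap_le x
    _ ≤ C * 1 + 2 * C := by
        have : |g'| * ‖x‖ = |u - g ‖x‖| := by
          rw [← hxu, add_sub_cancel_left, abs_mul, abs_norm]
        rw [this]
        gcongr
        linarith [abs_sub u (g ‖x‖)]
    _ = _ := by ring

end Radial

/-! ### Consequences of the assumptions on the data -/

section Data

/-- A `C^2` function on `[0, ∞)` is the restriction of a `C^1` function on `ℝ`. -/
theorem exists_contDiff_extension {f : ℝ → ℝ} (hf : ContDiffOn ℝ 2 f (Ici 0)) :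
    ∃ g : ℝ → ℝ, ContDiff ℝ 1 g ∧ ∀ x, 0 ≤ x → g x = f x := by
  have hc : ContinuousOn (derivWithin f (Ici 0)) (Ici 0) :=
    hf.continuousOn_derivWithin (uniqueDiffOn_Ici 0) one_le_two
  -- The derivative is frozen at its value at `0` for negative arguments; its primitive is the
  -- extension.
  set h : ℝ → ℝ := fun x => derivWithin f (Ici 0) (max x 0) with hh
  have hcont : Continuous h :=
    hc.comp_continuous (continuous_id.max continuous_const) fun x => mem_Ici.2 (le_max_right _ _)
  have hd (x : ℝ) : HasDerivAt (fun x => f 0 + ∫ s in (0 : ℝ)..x, h s) (h x) x :=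
    (intervalIntegral.integral_hasDerivAt_right (hcont.intervalIntegrable _ _)
      hcont.stronglyMeasurable.stronglyMeasurableAtFilter hcont.continuousAt).const_add _
  refine ⟨fun x => f 0 + ∫ s in (0 : ℝ)..x, h s, ?_, fun x hx => ?_⟩
  · rw [contDiff_one_iff_deriv]
    refine ⟨fun x => (hd x).differentiableAt, ?_⟩
    have : deriv (fun x => f 0 + ∫ s in (0 : ℝ)..x, h s) = h := funext fun x => (hd x).deriv
    rwa [this]
  · have := intervalIntegral.integral_eq_sub_of_hasDeriv_right (a := 0) (b := x) (f := f) (f' := h)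
      (by rw [uIcc_of_le hx]; exact hf.continuousOn.mono Icc_subset_Ici_self) (fun s hs => by
        rw [min_eq_left hx] at hs
        have hs0 : (0 : ℝ) ≤ s := hs.1.le
        have := ((hf.differentiableOn two_ne_zero) s hs0).hasDerivWithinAt
        rw [show derivWithin f (Ici 0) s = h s by simp [hh, max_eq_left hs0]] at this
        exact this.mono fun y (hy : s < y) => hs0.trans hy.le) (hcont.intervalIntegrable _ _)
    simp [this]

/-- The mean density is positive if the density is. -/
theorem mean_pos_of_pos {n : ℕ} {k : ℝ} {G : ℝ → ℝ} (hn : 1 ≤ n)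
    (hG : ContDiff ℝ 1 G) (h : ∀ ρ, 0 ≤ ρ → 0 < k - n * G ρ - ρ * deriv G ρ) :
    ∀ ρ, 0 ≤ ρ → 0 < k - n * G ρ := by
  have hn0 : n ≠ 0 := by omega
  -- A radial divergence theorem: `ρ^n` times the mean is the integral of the density against `n
  -- ρ^(n-1)`.
  have hd (ρ : ℝ) : HasDerivAt (fun ρ => ρ ^ n * (k - n * G ρ))
      (n * ρ ^ (n - 1) * (k - n * G ρ - ρ * deriv G ρ)) ρ := by
    have h1 := (hG.differentiable one_ne_zero ρ).hasDerivAt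
    refine ((hasDerivAt_pow n ρ).mul ((h1.const_mul (n : ℝ)).const_sub k)).congr_deriv ?_
    obtain ⟨m, rfl⟩ := Nat.exists_eq_succ_of_ne_zero hn0
    simp only [Nat.succ_eq_add_one, Nat.add_sub_cancel, pow_succ]
    ring
  have hmono : StrictMonoOn (fun ρ => ρ ^ n * (k - n * G ρ)) (Ici 0) := by
    refine strictMonoOn_of_hasDerivWithinAt_pos (convex_Ici 0)
      (fun ρ _ => (hd ρ).continuousAt.continuousWithinAt)
      (fun ρ _ => (hd ρ).hasDerivWithinAt) fun ρ hρ => ?_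
    rw [interior_Ici] at hρ
    have hρ' : (0 : ℝ) < ρ := hρ
    have hn' : (0 : ℝ) < n := by exact_mod_cast hn
    have := h ρ hρ'.le
    positivity
  intro ρ hρ
  rcases hρ.eq_or_lt with rfl | hpos
  · simpa using h 0 le_rfl
  · have := hmono (mem_Ici.2 le_rfl) hρ hpos
    simp only [zero_pow hn0, zero_mul] at this
    exact (mul_pos_iff_of_pos_left (by positivity)).1 this

theorem exists_unit_vector {d : ℕ} (hd : 1 ≤ d) : ∃ e : Space d, ‖e‖ = 1 :=
  ⟨EuclideanSpace.single ⟨0, hd⟩ 1, by simp⟩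

/-- A radial field with finite `C^1` norm has bounded coefficients. -/
theorem exists_bound_of_c1Norm_lt_top {d : ℕ} (hd : 1 ≤ d) {g : ℝ → ℝ} (hg : ContDiff ℝ 1 g)
    (h : c1Norm (radialField d g) < ⊤) : ∃ B, 0 ≤ B ∧ ∀ ρ, 0 ≤ ρ →
      |g ρ| ≤ B ∧ |ρ * g ρ| ≤ B ∧ |ρ * deriv g ρ| ≤ B := by
  obtain ⟨e, he⟩ := exists_unit_vector hd
  rw [c1Norm, ENNReal.add_lt_top] at h
  set W := radialField d g with hW
  set B₁ := (⨆ x, ‖W x‖ₑ).toReal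
  set B₂ := (⨆ x, ‖fderiv ℝ W x‖ₑ).toReal
  have hB₁ (x : Space d) : ‖W x‖ ≤ B₁ := by
    rw [← toReal_enorm]
    exact ENNReal.toReal_mono h.1.ne (le_iSup (fun x => ‖W x‖ₑ) x)
  have hB₂ (x : Space d) : ‖fderiv ℝ W x‖ ≤ B₂ := by
    rw [← toReal_enorm]
    exact ENNReal.toReal_mono h.2.ne (le_iSup (fun x => ‖fderiv ℝ W x‖ₑ) x)
  have hB₁0 : 0 ≤ B₁ := ENNReal.toReal_nonneg
  have hB₂0 : 0 ≤ B₂ := ENNReal.toReal_nonneg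
  have hne (ρ : ℝ) (hρ : 0 ≤ ρ) : ‖ρ • e‖ = ρ := by
    rw [norm_smul, he, mul_one, Real.norm_of_nonneg hρ]
  have h1 (ρ : ℝ) (hρ : 0 ≤ ρ) : |ρ * g ρ| ≤ B₁ := by
    have := hB₁ (ρ • e)
    rw [hW, radialField, hne ρ hρ, norm_smul, hne ρ hρ, Real.norm_eq_abs] at this
    rwa [abs_mul, abs_of_nonneg hρ, mul_comm]
  -- Mean value inequality on the segment from the origin, where `W` vanishes.
  have h2 (ρ : ℝ) (hρ : 0 < ρ) : |g ρ| ≤ B₂ := by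
    have := convex_univ.norm_image_sub_le_of_norm_fderiv_le (f := W) (C := B₂) (x := 0)
      (y := ρ • e) (fun x _ => (hasFDerivAt_radialField hg x).differentiableAt) (fun x _ => hB₂ x)
      (mem_univ _) (mem_univ _)
    rw [hW, radialField, radialField, smul_zero, sub_zero, sub_zero, hne ρ hρ.le, norm_smul,
      hne ρ hρ.le, Real.norm_eq_abs] at this
    exact le_of_mul_le_mul_right this hρ
  have h2' (ρ : ℝ) (hρ : 0 ≤ ρ) : |g ρ| ≤ B₂ := by
    rcases hρ.eq_or_lt with rfl | hpos
    · refine le_of_tendsto (x := 𝓝[>] (0 : ℝ)) (hg.continuous.abs.continuousAt.tendsto.mono_left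
        nhdsWithin_le_nhds) ?_
      filter_upwards [self_mem_nhdsWithin] with ρ hρ using h2 ρ hρ
    · exact h2 ρ hpos
  -- The radial eigenvalue `g + ρ g'` of the derivative is bounded by its norm; subtracting `g`
  -- leaves `ρ g'`.
  have h3 (ρ : ℝ) (hρ : 0 ≤ ρ) : |ρ * deriv g ρ| ≤ 2 * B₂ := by
    rcases hρ.eq_or_lt with rfl | hpos
    · simpa using hB₂0
    have h4 := hB₂ (ρ • e)
    rw [(hasFDerivAt_radialField hg (ρ • e)).fderiv, hne ρ hρ] at h4
    have h5 := (ContinuousLinearMap.le_opNorm (g ρ • ContinuousLinearMap.id ℝ (Space d) +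
      deriv g ρ • radialMap (ρ • e)) (ρ • e)).trans
      (mul_le_mul_of_nonneg_right h4 (norm_nonneg _))
    simp only [add_apply, smul_apply,
      ContinuousLinearMap.id_apply, radialMap_self, hne ρ hρ] at h5
    rw [smul_smul (deriv g ρ), ← add_smul, norm_smul, hne ρ hρ, Real.norm_eq_abs] at h5
    have h6 : |g ρ + deriv g ρ * ρ| ≤ B₂ := le_of_mul_le_mul_right h5 hpos
    have h7 := h2' ρ hρ
    have h8 := abs_sub (g ρ + deriv g ρ * ρ) (g ρ)
    rw [add_sub_cancel_left] at h8
    rw [mul_comm ρ]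
    linarith
  refine ⟨B₁ + 2 * B₂, by positivity, fun ρ hρ => ⟨?_, ?_, ?_⟩⟩
  · linarith [h2' ρ hρ]
  · linarith [h1 ρ hρ]
  · linarith [h3 ρ hρ]

end Data

/-! ### From characteristics to fields on space-time -/

section Euler

variable {d : ℕ} {D ν A B : ℝ} {F₀ G₀ : ℝ → ℝ} {F G l Fρ Gρ lρ : ℝ → ℝ → ℝ}

/-- `inv t` is the inverse of the radial flow map `ρ ↦ ρ exp (l t ρ)` on `[0, ∞)`. -/
structure IsRadialInverse (l inv : ℝ → ℝ → ℝ) : Prop where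
  nonneg : ∀ t r, 0 ≤ t → 0 ≤ r → 0 ≤ inv t r
  apply_inv : ∀ t r, 0 ≤ t → 0 ≤ r → inv t r * Real.exp (l t (inv t r)) = r
  inv_apply : ∀ t ρ, 0 ≤ t → 0 ≤ ρ → inv t (ρ * Real.exp (l t ρ)) = ρ

/-- The flow map is strictly increasing because the Jacobian factor is positive, and onto because `F
> -ν/8` limits how far a radius can shrink. -/
theorem IsCharFamily.exists_inverse (h : IsCharFamily D ν A B F₀ G₀ F G l Fρ Gρ lρ) :
    ∃ inv, IsRadialInverse l inv := by
  have hmono (t : ℝ) (ht : 0 ≤ t) : StrictMonoOn (fun ρ => ρ * Real.exp (l t ρ)) (Ici 0) := by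
    have hd (ρ : ℝ) : HasDerivAt (fun ρ => ρ * Real.exp (l t ρ))
        (Real.exp (l t ρ) * (1 + ρ * lρ t ρ)) ρ := by
      refine ((hasDerivAt_id ρ).mul (h.hasDerivAt_l_snd t ρ).exp).congr_deriv ?_
      simp only [id]
      ring
    refine strictMonoOn_of_hasDerivWithinAt_pos (convex_Ici 0)
      (fun ρ _ => (hd ρ).continuousAt.continuousWithinAt)
      (fun ρ _ => (hd ρ).hasDerivWithinAt) fun ρ hρ => ?_
    have hρ' : 0 ≤ ρ := interior_subset hρ
    have h1 := h.lt_jacobian t ρ ht hρ'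
    have h2 := Real.exp_pos (-(ν / 2) * t)
    exact mul_pos (Real.exp_pos _) (by linarith)
  have hl (t ρ : ℝ) (ht : 0 ≤ t) (hρ : 0 ≤ ρ) : -(ν / 8 * t) ≤ l t ρ := by
    have hm : MonotoneOn (fun t => l t ρ + ν / 8 * t) (Ici 0) := by
      refine monotoneOn_of_hasDerivWithinAt_nonneg (f' := fun t => F t ρ + ν / 8) (convex_Ici 0)
        (fun s hs => ?_) (fun s hs => ?_) fun s hs => ?_
      · exact ((h.hasDerivAt_l s ρ hs hρ).add
          ((hasDerivAt_id s).const_mul (ν / 8))).continuousAt.continuousWithinAt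
      · refine (((h.hasDerivAt_l s ρ (interior_subset hs) hρ).add
          ((hasDerivAt_id s).const_mul (ν / 8))).congr_deriv ?_).hasDerivWithinAt
        ring
      · linarith [h.lt_F s ρ (interior_subset hs) hρ]
    have := hm (mem_Ici.2 le_rfl) ht ht
    simp only [h.l_zero] at this
    linarith
  have hsurj (t r : ℝ) : ∃ ρ, 0 ≤ t → 0 ≤ r → 0 ≤ ρ ∧ ρ * Real.exp (l t ρ) = r := by
    by_cases htr : 0 ≤ t ∧ 0 ≤ r
    · obtain ⟨ht, hr⟩ := htr
      -- A radius whose image at time `t` is still at least `r`.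
      set M := r * Real.exp (ν / 8 * t) with hM
      have hM0 : 0 ≤ M := by positivity
      have hcont : Continuous fun ρ => ρ * Real.exp (l t ρ) := by
        have : Continuous (l t) := h.contDiff_l.continuous.comp (by fun_prop : Continuous fun ρ => (t, ρ))
        fun_prop
      have hle : r ≤ M * Real.exp (l t M) := by
        have := hl t M ht hM0
        calc r = M * Real.exp (-(ν / 8 * t)) := by
              rw [hM, mul_assoc, ← Real.exp_add]; simp
          _ ≤ _ := by gcongr
      obtain ⟨ρ, hρ, hρr⟩ := intermediate_value_Icc hM0 hcont.continuousOn
        (show r ∈ Icc _ _ from ⟨by simpa using hr, hle⟩)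
      exact ⟨ρ, fun _ _ => ⟨hρ.1, hρr⟩⟩
    · exact ⟨0, fun h1 h2 => absurd ⟨h1, h2⟩ htr⟩
  choose inv hinv using hsurj
  refine ⟨inv, fun t r ht hr => (hinv t r ht hr).1, fun t r ht hr => (hinv t r ht hr).2,
    fun t ρ ht hρ => ?_⟩
  have hr : 0 ≤ ρ * Real.exp (l t ρ) := by positivity
  exact (hmono t ht).injOn (hinv t _ ht hr).1 hρ (hinv t _ ht hr).2

theorem fderiv_apply_zero_one {ψ : ℝ × ℝ → ℝ} (hψ : ContDiff ℝ 1 ψ) {t ρ c : ℝ}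
    (h : HasDerivAt (fun r => ψ (t, r)) c ρ) : fderiv ℝ ψ (t, ρ) (0, 1) = c := by
  have h1 : HasDerivAt (fun r : ℝ => (t, r)) ((0 : ℝ), (1 : ℝ)) ρ :=
    (hasDerivAt_const ρ t).prodMk (hasDerivAt_id ρ)
  exact ((hψ.differentiable one_ne_zero (t, ρ)).hasFDerivAt.comp_hasDerivAt
    (f := fun r : ℝ => (t, r)) ρ h1).unique h

theorem fderiv_apply_one_zero {ψ : ℝ × ℝ → ℝ} (hψ : ContDiff ℝ 1 ψ) {t ρ c : ℝ}
    (h : HasDerivAt (fun s => ψ (s, ρ)) c t) : fderiv ℝ ψ (t, ρ) (1, 0) = c := by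
  have h1 : HasDerivAt (fun s : ℝ => (s, ρ)) ((1 : ℝ), (0 : ℝ)) t :=
    (hasDerivAt_id t).prodMk (hasDerivAt_const t ρ)
  exact ((hψ.differentiable one_ne_zero (t, ρ)).hasFDerivAt.comp_hasDerivAt
    (f := fun s : ℝ => (s, ρ)) t h1).unique h

theorem norm_exp_smul (a : ℝ) (ξ : Space d) : ‖Real.exp a • ξ‖ = ‖ξ‖ * Real.exp a := by
  rw [norm_smul, Real.norm_of_nonneg (Real.exp_pos _).le, mul_comm]

/-- Near each point of `[0, ∞) × ℝ^d`, a field transported by the radial flow is the restriction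
of a `C^1` field, whose derivative is determined by the flow. -/
theorem IsCharFamily.exists_local_extension (h : IsCharFamily D ν A B F₀ G₀ F G l Fρ Gρ lρ)
    {inv : ℝ → ℝ → ℝ} (hinv : IsRadialInverse l inv) {c : ℝ → ℝ → ℝ}
    (hc : ContDiff ℝ 1 fun p : ℝ × ℝ => c p.1 p.2) {t : ℝ} (ht : 0 ≤ t) (ξ : Space d) :
    ∃ W : ℝ × Space d → Space d, ContDiffAt ℝ 1 W (t, Real.exp (l t ‖ξ‖) • ξ) ∧
      (∀ᶠ y in 𝓝 (t, Real.exp (l t ‖ξ‖) • ξ), 0 ≤ y.1 →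
        W y = radialField d (fun r => c y.1 (inv y.1 r)) y.2) ∧
      ∀ τ w, fderiv ℝ W (t, Real.exp (l t ‖ξ‖) • ξ)
          (τ, radialFDeriv (fun p => Real.exp (l p.1 p.2)) (t, ξ) (τ, w)) =
        radialFDeriv (fun p => c p.1 p.2 * Real.exp (l p.1 p.2)) (t, ξ) (τ, w) := by
  set q : ℝ × ℝ → ℝ := fun p => Real.exp (l p.1 p.2) with hq
  have hqs : ContDiff ℝ 1 q := h.contDiff_l.exp
  set φ : ℝ × ℝ → ℝ := fun p => c p.1 p.2 * Real.exp (l p.1 p.2) with hφ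
  have hφs : ContDiff ℝ 1 φ := hc.mul hqs
  -- The family is `C^1` on all of `ℝ × ℝ`, so `Ψ` makes sense for negative times as well and the
  -- inverse function theorem applies at `t = 0` too.
  set Ψ : ℝ × Space d → ℝ × Space d := fun p => (p.1, q (p.1, ‖p.2‖) • p.2) with hΨ
  have hΨs : ContDiff ℝ 1 Ψ := contDiff_fst.prodMk (contDiff_radial hqs)
  set L : ℝ × Space d →L[ℝ] ℝ × Space d :=
    (ContinuousLinearMap.fst ℝ ℝ (Space d)).prod (radialFDeriv q (t, ξ)) with hL
  have hΨd : HasFDerivAt Ψ L (t, ξ) := hasFDerivAt_fst.prodMk (hasFDerivAt_radial hqs (t, ξ))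
  have hqρ : fderiv ℝ q (t, ‖ξ‖) (0, 1) = Real.exp (l t ‖ξ‖) * lρ t ‖ξ‖ :=
    fderiv_apply_zero_one hqs (h.hasDerivAt_l_snd t ‖ξ‖).exp
  have hker : ∀ v, L v = 0 → v = 0 := by
    rintro ⟨τ, w⟩ hv
    have h1 : τ = 0 := congrArg Prod.fst hv
    have h2 : radialFDeriv q (t, ξ) (τ, w) = 0 := congrArg Prod.snd hv
    subst h1
    rw [radialFDeriv_apply, hqρ, mul_zero, zero_smul, add_zero, radialMap_apply] at h2
    have hq0 : 0 < Real.exp (l t ‖ξ‖) := Real.exp_pos _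
    -- Pairing with `ξ` isolates the radial direction, where the derivative is `exp l * (1 + ρ lρ) ≠
    -- 0`; the remaining directions are only scaled by `exp l`.
    have hin : inner ℝ ξ w = 0 := by
      rcases eq_or_ne ξ 0 with rfl | hξ
      · simp
      have hξ' : ‖ξ‖ ≠ 0 := norm_ne_zero_iff.2 hξ
      have h3 := congrArg (fun z => inner ℝ ξ z) h2
      simp only [inner_add_right, real_inner_smul_right, inner_zero_right,
        real_inner_self_eq_norm_sq, hq] at h3
      have h4 : Real.exp (l t ‖ξ‖) * (1 + ‖ξ‖ * lρ t ‖ξ‖) * inner ℝ ξ w = 0 := by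
        rw [← h3]; field_simp
      have h5 := h.lt_jacobian t ‖ξ‖ ht (norm_nonneg _)
      have h6 := Real.exp_pos (-(ν / 2) * t)
      have h7 : Real.exp (l t ‖ξ‖) * (1 + ‖ξ‖ * lρ t ‖ξ‖) ≠ 0 :=
        mul_ne_zero hq0.ne' (by linarith)
      exact (mul_eq_zero.1 h4).resolve_left h7
    rw [hin] at h2
    simp only [mul_zero, zero_smul, smul_zero, add_zero] at h2
    rw [(smul_eq_zero.1 h2).resolve_left hq0.ne']
    rfl
  set e : (ℝ × Space d) ≃L[ℝ] (ℝ × Space d) := (LinearEquiv.ofInjectiveEndo (L : _ →ₗ[ℝ] _)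
    ((injective_iff_map_eq_zero _).2 hker)).toContinuousLinearEquiv with he
  have hLe : (e : ℝ × Space d →L[ℝ] ℝ × Space d) = L := by
    exact ContinuousLinearMap.ext fun v => rfl
  have hΨe : HasFDerivAt Ψ (e : ℝ × Space d →L[ℝ] ℝ × Space d) (t, ξ) := by rwa [hLe]
  have hst := hΨs.contDiffAt.hasStrictFDerivAt' hΨe one_ne_zero
  set k := hΨs.contDiffAt.localInverse hΨe one_ne_zero with hk
  have hkc : ContDiffAt ℝ 1 k (Ψ (t, ξ)) := hΨs.contDiffAt.to_localInverse hΨe one_ne_zero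
  have hk0 : k (Ψ (t, ξ)) = (t, ξ) := hΨs.contDiffAt.localInverse_apply_image hΨe one_ne_zero
  have hkr : ∀ᶠ y in 𝓝 (Ψ (t, ξ)), Ψ (k y) = y := hst.eventually_right_inverse
  have hkd : HasFDerivAt k (e.symm : ℝ × Space d →L[ℝ] ℝ × Space d) (Ψ (t, ξ)) :=
    hst.to_localInverse.hasFDerivAt
  set P : ℝ × Space d → Space d := fun p => φ (p.1, ‖p.2‖) • p.2 with hP
  have hPs : ContDiff ℝ 1 P := contDiff_radial hφs
  refine ⟨P ∘ k, hPs.contDiffAt.comp _ hkc, ?_, fun τ w => ?_⟩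
  · filter_upwards [hkr] with y hy hy0
    have h1 : (k y).1 = y.1 := (Prod.ext_iff.1 hy).1
    have h2 : Real.exp (l y.1 ‖(k y).2‖) • (k y).2 = y.2 := by
      rw [← h1]; exact (Prod.ext_iff.1 hy).2
    have h3 : inv y.1 ‖y.2‖ = ‖(k y).2‖ := by
      rw [← h2, norm_exp_smul, hinv.inv_apply y.1 _ hy0 (norm_nonneg _)]
    simp only [Function.comp_apply, hP, hφ, radialField, h1, h3]
    rw [mul_smul, h2]
  · have hcomp : HasFDerivAt (P ∘ k)
        ((radialFDeriv φ (t, ξ)).comp (e.symm : ℝ × Space d →L[ℝ] ℝ × Space d)) (Ψ (t, ξ)) := by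
      refine HasFDerivAt.comp _ ?_ hkd
      rw [hk0]
      exact hasFDerivAt_radial hφs (t, ξ)
    have hpt : (t, Real.exp (l t ‖ξ‖) • ξ) = Ψ (t, ξ) := rfl
    rw [hpt, hcomp.fderiv]
    have hev : (τ, radialFDeriv q (t, ξ) (τ, w)) = e (τ, w) := by
      change L (τ, w) = _
      rw [← hLe]; rfl
    rw [hev, ContinuousLinearMap.comp_apply]
    congr 1
    exact e.symm_apply_apply _

/-- Regularity and derivatives of a field transported by the radial flow. -/
theorem IsCharFamily.transported (h : IsCharFamily D ν A B F₀ G₀ F G l Fρ Gρ lρ)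
    {inv : ℝ → ℝ → ℝ} (hinv : IsRadialInverse l inv) {c : ℝ → ℝ → ℝ}
    (hc : ContDiff ℝ 1 fun p : ℝ × ℝ => c p.1 p.2) {t : ℝ} (ht : 0 ≤ t) (ξ : Space d) {ct cρ : ℝ}
    (hct : HasDerivAt (fun s => c s ‖ξ‖) ct t) (hcρ : HasDerivAt (c t) cρ ‖ξ‖) :
    let W : ℝ → Space d → Space d := fun t => radialField d (fun r => c t (inv t r))
    let x := Real.exp (l t ‖ξ‖) • ξ
    ContDiffWithinAt ℝ 1 (fun p : ℝ × Space d => W p.1 p.2) (Ici 0 ×ˢ univ) (t, x) ∧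
      DifferentiableAt ℝ (W t) x ∧
      HasDerivWithinAt (fun s => W s x)
        ((ct + c t ‖ξ‖ * F t ‖ξ‖) • x - fderiv ℝ (W t) x (F t ‖ξ‖ • x)) (Ici 0) t ∧
      fderiv ℝ (W t) x x = (c t ‖ξ‖ + ‖ξ‖ * cρ / (1 + ‖ξ‖ * lρ t ‖ξ‖)) • x := by
  intro W x
  obtain ⟨U, hU, hUW, hUd⟩ := h.exists_local_extension hinv hc ht ξ
  change ContDiffAt ℝ 1 U (t, x) at hU
  change ∀ᶠ y in 𝓝 (t, x), 0 ≤ y.1 → U y = W y.1 y.2 at hUW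
  change ∀ τ w, fderiv ℝ U (t, x) (τ, _) = _ at hUd
  have hUf : HasFDerivAt U (fderiv ℝ U (t, x)) (t, x) :=
    (hU.differentiableAt one_ne_zero).hasFDerivAt
  have htime : Tendsto (fun s : ℝ => (s, x)) (𝓝 t) (𝓝 (t, x)) :=
    (continuous_id.prodMk continuous_const).tendsto t
  have hspace : Tendsto (fun y : Space d => (t, y)) (𝓝 x) (𝓝 (t, x)) :=
    (continuous_const.prodMk continuous_id).tendsto x
  have hWspace : W t =ᶠ[𝓝 x] fun y => U (t, y) := by
    filter_upwards [hspace.eventually hUW] with y hy using (hy ht).symm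
  have hsd : HasFDerivAt (fun y : Space d => (t, y))
      ((0 : Space d →L[ℝ] ℝ).prod (ContinuousLinearMap.id ℝ (Space d))) x :=
    (hasFDerivAt_const t x).prodMk (hasFDerivAt_id x)
  have hWd : HasFDerivAt (W t) ((fderiv ℝ U (t, x)).comp
      ((0 : Space d →L[ℝ] ℝ).prod (ContinuousLinearMap.id ℝ (Space d)))) x :=
    (HasFDerivAt.comp (f := fun y : Space d => (t, y)) x hUf hsd).congr_of_eventuallyEq hWspace
  have hWf (w : Space d) : fderiv ℝ (W t) x w = fderiv ℝ U (t, x) (0, w) := by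
    rw [hWd.fderiv]; rfl
  have hqs : ContDiff ℝ 1 fun p : ℝ × ℝ => Real.exp (l p.1 p.2) := h.contDiff_l.exp
  have hφs : ContDiff ℝ 1 fun p : ℝ × ℝ => c p.1 p.2 * Real.exp (l p.1 p.2) := hc.mul hqs
  have e1 := fderiv_apply_zero_one hqs (h.hasDerivAt_l_snd t ‖ξ‖).exp
  have e2 := fderiv_apply_one_zero hqs (h.hasDerivAt_l t ‖ξ‖ ht (norm_nonneg _)).exp
  have e3 := fderiv_apply_zero_one hφs (hcρ.mul (h.hasDerivAt_l_snd t ‖ξ‖).exp)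
  have e4 := fderiv_apply_one_zero hφs (hct.mul (h.hasDerivAt_l t ‖ξ‖ ht (norm_nonneg _)).exp)
  refine ⟨?_, hWd.differentiableAt, ?_, ?_⟩
  · refine hU.contDiffWithinAt.congr_of_eventuallyEq ?_ ?_
    · filter_upwards [nhdsWithin_le_nhds hUW, self_mem_nhdsWithin] with y hy hy' using
        (hy hy'.1).symm
    · exact (hUW.self_of_nhds ht).symm
  · have htd : HasDerivAt (fun s : ℝ => (s, x)) ((1 : ℝ), (0 : Space d)) t :=
      (hasDerivAt_id t).prodMk (hasDerivAt_const t x)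
    have h1 : HasDerivAt (fun s => U (s, x)) (fderiv ℝ U (t, x) (1, 0)) t :=
      hUf.comp_hasDerivAt (f := fun s : ℝ => (s, x)) t htd
    have h2 : HasDerivWithinAt (fun s => W s x) (fderiv ℝ U (t, x) (1, 0)) (Ici 0) t := by
      refine h1.hasDerivWithinAt.congr_of_eventuallyEq ?_ ?_
      · filter_upwards [nhdsWithin_le_nhds (htime.eventually hUW), self_mem_nhdsWithin] with s hs hs'
          using (hs hs').symm
      · exact (hUW.self_of_nhds ht).symm
    refine h2.congr_deriv ?_
    -- Differentiation in time with the label `ξ` fixed: the material derivative.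
    have h3 := hUd 1 0
    rw [radialFDeriv_apply, radialFDeriv_apply] at h3
    simp only [e2, e4, smul_zero, map_zero, zero_add, add_zero, mul_one] at h3
    have h4 : (Real.exp (l t ‖ξ‖) * F t ‖ξ‖) • ξ = F t ‖ξ‖ • x := by
      simp only [x, smul_smul, mul_comm]
    rw [h4] at h3
    rw [hWf, eq_sub_iff_add_eq, ← map_add, Prod.mk_add_mk, add_zero, zero_add, h3]
    simp only [x, smul_smul]
    congr 1
    ring
  -- Differentiation in the label along the ray gives the radial derivative, after division by the
  -- Jacobian factor.
  · have h3 := hUd 0 ξ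
    rw [radialFDeriv_apply, radialFDeriv_apply, radialMap_self] at h3
    simp only [e1, e3, mul_zero, zero_smul, add_zero, smul_smul, ← add_smul] at h3
    rw [← hWf] at h3
    have h5 := h.lt_jacobian t ‖ξ‖ ht (norm_nonneg _)
    have h6 := Real.exp_pos (-(ν / 2) * t)
    have h7 : 1 + ‖ξ‖ * lρ t ‖ξ‖ ≠ 0 := by linarith
    have h8 : (Real.exp (l t ‖ξ‖) + Real.exp (l t ‖ξ‖) * lρ t ‖ξ‖ * ‖ξ‖) • ξ =
        (1 + ‖ξ‖ * lρ t ‖ξ‖) • x := by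
      simp only [x, smul_smul]; congr 1; ring
    rw [h8, map_smul] at h3
    rw [← inv_smul_smul₀ h7 (fderiv ℝ (W t) x x), h3]
    simp only [x, smul_smul]
    congr 1
    field_simp
    ring

theorem IsRadialInverse.exists_preimage {inv : ℝ → ℝ → ℝ} (hinv : IsRadialInverse l inv) {t : ℝ}
    (ht : 0 ≤ t) (x : Space d) :
    ∃ ξ : Space d, Real.exp (l t ‖ξ‖) • ξ = x ∧ inv t ‖x‖ = ‖ξ‖ := by
  set ρ := inv t ‖x‖ with hρ
  have hρ0 : 0 ≤ ρ := hinv.nonneg t _ ht (norm_nonneg _)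
  have hρx : ρ * Real.exp (l t ρ) = ‖x‖ := hinv.apply_inv t _ ht (norm_nonneg _)
  refine ⟨Real.exp (-l t ρ) • x, ?_, ?_⟩
  · have : ‖Real.exp (-l t ρ) • x‖ = ρ := by
      rw [norm_exp_smul, ← hρx, mul_assoc, ← Real.exp_add]; simp
    rw [this, smul_smul, ← Real.exp_add]; simp
  · rw [norm_exp_smul, ← hρx, mul_assoc, ← Real.exp_add]; simp

/-- The equations of `F` and `G` are the material derivatives of the system. In the field equation,
`DE(x) x = (div E) x - (d - 1) G x` converts transport by `V` into the term `V div E`. -/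
theorem IsCharFamily.isRadialSolution (h : IsCharFamily d ν A B F₀ G₀ F G l Fρ Gρ lρ)
    {inv : ℝ → ℝ → ℝ} (hinv : IsRadialInverse l inv) {f₀ g₀ : ℝ → ℝ}
    (hf : ∀ r, 0 ≤ r → F₀ r = f₀ r) (hg : ∀ r, 0 ≤ r → G₀ r = g₀ r) :
    IsRadialSolution d ν f₀ g₀ (Ici 0) (fun t => radialField d (fun r => F t (inv t r)))
      (fun t => radialField d (fun r => G t (inv t r))) := by
  have hF (t : ℝ) (ht : 0 ≤ t) (ξ : Space d) := h.transported hinv h.contDiff_F ht ξ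
    (h.hasDerivAt_F t ‖ξ‖ ht (norm_nonneg _)) (h.hasDerivAt_F_snd t ‖ξ‖)
  have hG (t : ℝ) (ht : 0 ≤ t) (ξ : Space d) := h.transported hinv h.contDiff_G ht ξ
    (h.hasDerivAt_G t ‖ξ‖ ht (norm_nonneg _)) (h.hasDerivAt_G_snd t ‖ξ‖)
  have h0 (r : ℝ) (hr : 0 ≤ r) : inv 0 r = r := by
    have := hinv.inv_apply 0 r le_rfl hr
    rwa [h.l_zero, Real.exp_zero, mul_one] at this
  refine ⟨fun p hp => ?_, fun p hp => ?_, ⟨_, fun t _ => rfl⟩, ⟨_, fun t _ => rfl⟩,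
    fun t ht x => ?_, fun t ht x => ?_, ?_, ?_⟩
  · obtain ⟨t, x⟩ := p
    obtain ⟨ξ, rfl, -⟩ := hinv.exists_preimage (t := t) hp.1 x
    exact (hF t hp.1 ξ).1
  · obtain ⟨t, x⟩ := p
    obtain ⟨ξ, rfl, -⟩ := hinv.exists_preimage (t := t) hp.1 x
    exact (hG t hp.1 ξ).1
  · obtain ⟨ξ, rfl, hξ⟩ := hinv.exists_preimage (t := t) ht x
    refine (hF t ht ξ).2.2.1.congr_deriv ?_
    have hV : radialField d (fun r => F t (inv t r)) (Real.exp (l t ‖ξ‖) • ξ) =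
        F t ‖ξ‖ • Real.exp (l t ‖ξ‖) • ξ := by simp only [radialField, hξ]
    have hE : radialField d (fun r => G t (inv t r)) (Real.exp (l t ‖ξ‖) • ξ) =
        G t ‖ξ‖ • Real.exp (l t ‖ξ‖) • ξ := by simp only [radialField, hξ]
    rw [hV, hE]
    module
  · obtain ⟨ξ, rfl, hξ⟩ := hinv.exists_preimage (t := t) ht x
    refine (hG t ht ξ).2.2.1.congr_deriv ?_
    have hV : radialField d (fun r => F t (inv t r)) (Real.exp (l t ‖ξ‖) • ξ) =
        F t ‖ξ‖ • Real.exp (l t ‖ξ‖) • ξ := by simp only [radialField, hξ]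
    rw [hV, map_smul, fderiv_radialField_self (hG t ht ξ).2.1]
    simp only [hξ]
    module
  · funext x
    simp only [radialField, h0 _ (norm_nonneg x), h.F_zero, hf _ (norm_nonneg x)]
  · funext x
    simp only [radialField, h0 _ (norm_nonneg x), h.G_zero, hg _ (norm_nonneg x)]

end Euler

/-! ### Time-dependent fields along curves -/

section TimeDependent

variable {E₁ E₂ : Type*} [NormedAddCommGroup E₁] [NormedSpace ℝ E₁] [NormedAddCommGroup E₂]
  [NormedSpace ℝ E₂] {W : ℝ → E₁ → E₂} {I : Set ℝ}

theorem hasFDerivAt_slice (hW : ContDiffOn ℝ 1 (fun p : ℝ × E₁ => W p.1 p.2) (I ×ˢ univ))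
    {t : ℝ} (ht : t ∈ I) (x : E₁) :
    HasFDerivAt (W t) ((fderivWithin ℝ (fun p : ℝ × E₁ => W p.1 p.2) (I ×ˢ univ) (t, x)).comp
      (ContinuousLinearMap.inr ℝ ℝ E₁)) x := by
  have h1 := ((hW.differentiableOn one_ne_zero) (t, x) ⟨ht, mem_univ _⟩).hasFDerivWithinAt
  have h2 : HasFDerivAt (fun y : E₁ => (t, y)) (ContinuousLinearMap.inr ℝ ℝ E₁) x :=
    (hasFDerivAt_const t x).prodMk (hasFDerivAt_id x)
  have h3 := HasFDerivWithinAt.comp (f := fun y : E₁ => (t, y)) (s := univ) x h1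
    h2.hasFDerivWithinAt (fun y _ => ⟨ht, mem_univ _⟩)
  exact hasFDerivWithinAt_univ.1 h3

theorem continuousOn_fderiv_slice
    (hI : UniqueDiffOn ℝ I) (hW : ContDiffOn ℝ 1 (fun p : ℝ × E₁ => W p.1 p.2) (I ×ˢ univ))
    {X : ℝ → E₁} (hX : ContinuousOn X I) :
    ContinuousOn (fun s => fderiv ℝ (W s) (X s)) I := by
  have h1 := hW.continuousOn_fderivWithin (hI.prod uniqueDiffOn_univ) le_rfl
  have h2 : ContinuousOn (fun s => fderivWithin ℝ (fun p : ℝ × E₁ => W p.1 p.2) (I ×ˢ univ)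
      (s, X s)) I :=
    h1.comp (continuousOn_id.prodMk hX) fun s hs => ⟨hs, mem_univ _⟩
  refine (h2.clm_comp (continuousOn_const (c := ContinuousLinearMap.inr ℝ ℝ E₁))).congr
    fun s hs => (hasFDerivAt_slice hW hs (X s)).fderiv

/-- The material derivative of a time dependent field along a curve. -/
theorem hasDerivWithinAt_along_curve
    (hI : UniqueDiffOn ℝ I) (hW : ContDiffOn ℝ 1 (fun p : ℝ × E₁ => W p.1 p.2) (I ×ˢ univ))
    {t : ℝ} (ht : t ∈ I) {X : ℝ → E₁} {X' : E₁} (hX : HasDerivWithinAt X X' I t) {w : E₂}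
    (hw : HasDerivWithinAt (fun s => W s (X t)) w I t) :
    HasDerivWithinAt (fun s => W s (X s)) (w + fderiv ℝ (W t) (X t) X') I t := by
  have h1 := ((hW.differentiableOn one_ne_zero) (t, X t) ⟨ht, mem_univ _⟩).hasFDerivWithinAt
  have h2 : HasDerivWithinAt (fun s : ℝ => (s, X s)) ((1 : ℝ), X') I t :=
    (hasDerivWithinAt_id t I).prodMk hX
  have h3 : HasDerivWithinAt (fun s : ℝ => (s, X t)) ((1 : ℝ), (0 : E₁)) I t :=
    (hasDerivWithinAt_id t I).prodMk (hasDerivWithinAt_const t I (X t))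
  have h4 := HasFDerivWithinAt.comp_hasDerivWithinAt (f := fun s : ℝ => (s, X s)) t h1 h2
    fun s hs => ⟨hs, mem_univ _⟩
  have h5 := HasFDerivWithinAt.comp_hasDerivWithinAt (f := fun s : ℝ => (s, X t)) t h1 h3
    fun s hs => ⟨hs, mem_univ _⟩
  have h6 := (hI t ht).eq_deriv _ hw h5
  refine h4.congr_deriv ?_
  rw [(hasFDerivAt_slice hW ht (X t)).fderiv, h6, ContinuousLinearMap.comp_apply, ← map_add]
  simp

end TimeDependent

/-! ### Uniqueness among radial solutions -/

section Uniqueness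

variable {d : ℕ} {ν A B : ℝ} {F₀ G₀ : ℝ → ℝ} {F G l Fρ Gρ lρ : ℝ → ℝ → ℝ}

/-- Any radial solution coincides with the constructed one along its characteristics. -/
theorem IsCharFamily.eq_along_characteristic
    (h : IsCharFamily d ν A B F₀ G₀ F G l Fρ Gρ lρ) {f₀ g₀ : ℝ → ℝ}
    (hf : ∀ r, 0 ≤ r → F₀ r = f₀ r) (hg : ∀ r, 0 ≤ r → G₀ r = g₀ r)
    {T : ℝ} {V E : ℝ → Space d → Space d} (hVE : IsRadialSolution d ν f₀ g₀ (Ico 0 T) V E)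
    {t : ℝ} (ht : t ∈ Ico 0 T) (ξ : Space d) :
    V t (Real.exp (l t ‖ξ‖) • ξ) = F t ‖ξ‖ • Real.exp (l t ‖ξ‖) • ξ ∧
      E t (Real.exp (l t ‖ξ‖) • ξ) = G t ‖ξ‖ • Real.exp (l t ‖ξ‖) • ξ := by
  set I : Set ℝ := Ico 0 T with hI
  have hIu : UniqueDiffOn ℝ I := uniqueDiffOn_Ico 0 T
  set ρ := ‖ξ‖ with hρ
  have hρ0 : 0 ≤ ρ := norm_nonneg _
  set X : ℝ → Space d := fun s => Real.exp (l s ρ) • ξ with hX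
  have hXd (s : ℝ) (hs : s ∈ I) : HasDerivWithinAt X (F s ρ • X s) I s := by
    have := ((h.hasDerivAt_l s ρ hs.1 hρ0).exp.smul_const ξ).hasDerivWithinAt (s := I)
    refine this.congr_deriv ?_
    simp only [hX, smul_smul, mul_comm]
  have hXc : ContinuousOn X I := fun s hs => (hXd s hs).continuousWithinAt
  have hFd (s : ℝ) (hs : s ∈ I) := (h.hasDerivAt_F s ρ hs.1 hρ0).hasDerivWithinAt (s := I)
  have hGd (s : ℝ) (hs : s ∈ I) := (h.hasDerivAt_G s ρ hs.1 hρ0).hasDerivWithinAt (s := I)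
  have hFc : ContinuousOn (fun s => F s ρ) I := fun s hs => (hFd s hs).continuousWithinAt
  -- The comparison is made along the constructed characteristics. `U` and `Z` then solve a linear
  -- homogeneous system whose coefficients involve `DV` and `div E` of the other solution, and `E`
  -- itself is not differentiated further.
  set U : ℝ → Space d := fun s => V s (X s) - F s ρ • X s with hU
  set Z : ℝ → Space d := fun s => E s (X s) - G s ρ • X s with hZ
  set U' : ℝ → Space d := fun s => -Z s - ν • U s - fderiv ℝ (V s) (X s) (U s) with hU'
  set Z' : ℝ → Space d := fun s =>
    U s - divergence (E s) (X s) • U s - (((d : ℝ) - 1) * F s ρ) • Z s with hZ'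
  have hUd (s : ℝ) (hs : s ∈ I) : HasDerivWithinAt U (U' s) I s := by
    have h1 := hasDerivWithinAt_along_curve hIu hVE.contDiffOn_V hs (hXd s hs)
      (hVE.momentum s hs (X s))
    refine (h1.sub ((hFd s hs).smul (hXd s hs))).congr_deriv ?_
    have h2 : F s ρ • X s = V s (X s) - U s := by simp only [hU]; abel
    rw [h2, map_sub]
    simp only [hU', hU, hZ, map_sub]
    module
  have hZd (s : ℝ) (hs : s ∈ I) : HasDerivWithinAt Z (Z' s) I s := by
    have h1 := hasDerivWithinAt_along_curve hIu hVE.contDiffOn_E hs (hXd s hs)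
      (hVE.field s hs (X s))
    refine (h1.sub ((hGd s hs).smul (hXd s hs))).congr_deriv ?_
    obtain ⟨Γ, hΓ⟩ := hVE.radial_E
    -- Radiality of `E` expresses the transport term through `div E`, which cancels against the
    -- source up to a multiple of `U`.
    have h2 : fderiv ℝ (E s) (X s) (X s) =
        divergence (E s) (X s) • X s - ((d : ℝ) - 1) • E s (X s) := by
      have h3 := (hasFDerivAt_slice hVE.contDiffOn_E hs (X s)).differentiableAt
      rw [hΓ s hs] at h3 ⊢
      rw [fderiv_radialField_self h3]
      simp only [radialField, smul_smul]
    rw [map_smul, h2]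
    simp only [hZ', hU, hZ]
    module
  have hVc := continuousOn_fderiv_slice hIu hVE.contDiffOn_V hXc
  have hEc := continuousOn_fderiv_slice hIu hVE.contDiffOn_E hXc
  have hdc : ContinuousOn (fun s => divergence (E s) (X s)) I := by
    unfold divergence
    refine continuousOn_finsetSum _ fun i _ => ?_
    have := (hEc.clm_apply (continuousOn_const (c := EuclideanSpace.single i (1 : ℝ))))
    exact (EuclideanSpace.proj (𝕜 := ℝ) i).continuous.comp_continuousOn this
  have hsub : Icc 0 t ⊆ I := fun s hs => ⟨hs.1, hs.2.trans_lt ht.2⟩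
  -- The coefficients are continuous, hence bounded on `[0, t]`, so Grönwall applies with zero data.
  obtain ⟨K, hK⟩ := isCompact_Icc.exists_bound_of_continuousOn (s := Icc 0 t)
    (f := fun s => 2 + |ν| + ‖fderiv ℝ (V s) (X s)‖ + |divergence (E s) (X s)| +
      |((d : ℝ) - 1) * F s ρ|)
    ((((continuousOn_const.add hVc.norm).add hdc.abs).add
      (continuousOn_const.mul hFc).abs).mono hsub)
  have hWd (s : ℝ) (hs : s ∈ I) : HasDerivWithinAt (fun s => (U s, Z s)) (U' s, Z' s) I s :=
    (hUd s hs).prodMk (hZd s hs)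
  have hzero := eq_zero_of_abs_deriv_le_mul_abs_self_of_eq_zero_right (a := 0) (b := t) (K := K)
    (f := fun s => (U s, Z s)) (f' := fun s => (U' s, Z' s))
    (fun s hs => ((hWd s (hsub hs)).continuousWithinAt).mono hsub)
    (fun s hs => (hWd s (hsub ⟨hs.1, hs.2.le⟩)).mono_of_mem_nhdsWithin
      (mem_of_superset (Ico_mem_nhdsGE (hs.2.trans ht.2)) (Ico_subset_Ico_left hs.1)))
    (by
      have hX0 : X 0 = ξ := by simp [hX, h.l_zero]
      simp only [hU, hZ, hX0, hVE.initial_V, hVE.initial_E, h.F_zero, h.G_zero,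
        radialField, hf _ hρ0, hg _ hρ0, ← hρ, sub_self, Prod.mk_zero_zero])
    (fun s hs => by
      have hKs := (le_abs_self _).trans (hK s ⟨hs.1, hs.2.le⟩)
      have hUn : ‖U s‖ ≤ ‖(U s, Z s)‖ := norm_fst_le (U s, Z s)
      have hZn : ‖Z s‖ ≤ ‖(U s, Z s)‖ := norm_snd_le (U s, Z s)
      have hN := norm_nonneg (U s, Z s)
      refine le_trans ?_ (mul_le_mul_of_nonneg_right hKs hN)
      have e1 : ‖U' s‖ ≤ ‖Z s‖ + |ν| * ‖U s‖ + ‖fderiv ℝ (V s) (X s)‖ * ‖U s‖ := by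
        refine (norm_sub_le _ _).trans (add_le_add ((norm_sub_le _ _).trans ?_)
          (ContinuousLinearMap.le_opNorm _ _))
        rw [norm_neg, norm_smul, Real.norm_eq_abs]
      have e2 : ‖Z' s‖ ≤ ‖U s‖ + |divergence (E s) (X s)| * ‖U s‖ +
          |((d : ℝ) - 1) * F s ρ| * ‖Z s‖ := by
        refine (norm_sub_le _ _).trans (add_le_add ((norm_sub_le _ _).trans ?_) ?_)
        · rw [norm_smul, Real.norm_eq_abs]
        · rw [norm_smul, Real.norm_eq_abs]
      have p1 := mul_le_mul_of_nonneg_left hUn (abs_nonneg ν)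
      have p2 := mul_le_mul_of_nonneg_left hUn (norm_nonneg (fderiv ℝ (V s) (X s)))
      have p3 := mul_le_mul_of_nonneg_left hUn (abs_nonneg (divergence (E s) (X s)))
      have p4 := mul_le_mul_of_nonneg_left hZn (abs_nonneg (((d : ℝ) - 1) * F s ρ))
      have q1 := mul_nonneg (abs_nonneg ν) hN
      have q2 := mul_nonneg (norm_nonneg (fderiv ℝ (V s) (X s))) hN
      have q3 := mul_nonneg (abs_nonneg (divergence (E s) (X s))) hN
      have q4 := mul_nonneg (abs_nonneg (((d : ℝ) - 1) * F s ρ)) hN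
      rw [Prod.norm_mk (U' s)]
      refine max_le ?_ ?_ <;> simp only [add_mul] <;> linarith)
    t (right_mem_Icc.2 ht.1)
  exact ⟨sub_eq_zero.1 (Prod.ext_iff.1 hzero).1, sub_eq_zero.1 (Prod.ext_iff.1 hzero).2⟩

theorem IsCharFamily.eq_of_isRadialSolution
    (h : IsCharFamily d ν A B F₀ G₀ F G l Fρ Gρ lρ) {inv : ℝ → ℝ → ℝ}
    (hinv : IsRadialInverse l inv) {f₀ g₀ : ℝ → ℝ}
    (hf : ∀ r, 0 ≤ r → F₀ r = f₀ r) (hg : ∀ r, 0 ≤ r → G₀ r = g₀ r)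
    {T : ℝ} {V E : ℝ → Space d → Space d} (hVE : IsRadialSolution d ν f₀ g₀ (Ico 0 T) V E)
    {t : ℝ} (ht : t ∈ Ico 0 T) :
    V t = radialField d (fun r => F t (inv t r)) ∧
      E t = radialField d (fun r => G t (inv t r)) := by
  refine ⟨funext fun x => ?_, funext fun x => ?_⟩
  · obtain ⟨ξ, rfl, hξ⟩ := hinv.exists_preimage ht.1 x
    simp only [radialField, hξ]
    exact (h.eq_along_characteristic hf hg hVE ht ξ).1
  · obtain ⟨ξ, rfl, hξ⟩ := hinv.exists_preimage ht.1 x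
    simp only [radialField, hξ]
    exact (h.eq_along_characteristic hf hg hVE ht ξ).2

end Uniqueness

/-! ### Bounds for the `C^1` norm and conclusion -/

/-- The three bounds control the tangential eigenvalue of the derivative, the value of the field,
and the radial eigenvalue. The constant is `M` for the value plus `3M` for the derivative. -/
theorem IsCharFamily.c1Norm_transported_le {d : ℕ} {ν A B : ℝ} {F₀ G₀ : ℝ → ℝ}
    {F G l Fρ Gρ lρ : ℝ → ℝ → ℝ} (h : IsCharFamily d ν A B F₀ G₀ F G l Fρ Gρ lρ)
    {inv : ℝ → ℝ → ℝ} (hinv : IsRadialInverse l inv) {c cρ : ℝ → ℝ → ℝ} {ct : ℝ → ℝ}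
    (hc : ContDiff ℝ 1 fun p : ℝ × ℝ => c p.1 p.2) {t : ℝ} (ht : 0 ≤ t)
    (hct : ∀ ρ, 0 ≤ ρ → HasDerivAt (fun s => c s ρ) (ct ρ) t)
    (hcρ : ∀ ρ, HasDerivAt (c t) (cρ t ρ) ρ) {M : ℝ}
    (h₁ : ∀ ρ, 0 ≤ ρ → |c t ρ| ≤ M) (h₂ : ∀ ρ, 0 ≤ ρ → |ρ * Real.exp (l t ρ) * c t ρ| ≤ M)
    (h₃ : ∀ ρ, 0 ≤ ρ → |c t ρ + ρ * cρ t ρ / (1 + ρ * lρ t ρ)| ≤ M) :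
    c1Norm (radialField d (fun r => c t (inv t r))) ≤ ENNReal.ofReal (4 * M) := by
  have hM : 0 ≤ M := (abs_nonneg _).trans (h₁ 0 le_rfl)
  set W := radialField d (fun r => c t (inv t r)) with hW
  have hc' (x : Space d) : |c t (inv t ‖x‖)| ≤ M := h₁ _ (hinv.nonneg t _ ht (norm_nonneg _))
  have hval (x : Space d) : ‖W x‖ ≤ M := by
    obtain ⟨ξ, rfl, hξ⟩ := hinv.exists_preimage ht x
    rw [hW, radialField, hξ, norm_smul, norm_exp_smul, Real.norm_eq_abs]
    have := h₂ ‖ξ‖ (norm_nonneg _)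
    rwa [abs_mul, abs_of_nonneg (by positivity), mul_comm] at this
  have hder (x : Space d) : ‖fderiv ℝ W x‖ ≤ 3 * M := by
    rcases eq_or_ne x 0 with rfl | hx
    -- At the origin the two-eigenvalue formula is not available; `|W y| ≤ M |y|` bounds the
    -- derivative directly.
    · refine (norm_fderiv_le_of_lip' (𝕜 := ℝ) hM (Eventually.of_forall fun y => ?_)).trans
        (by linarith)
      simp only [hW, radialField, smul_zero, sub_zero, norm_smul, Real.norm_eq_abs]
      exact mul_le_mul_of_nonneg_right (hc' y) (norm_nonneg _)
    · obtain ⟨ξ, rfl, hξ⟩ := hinv.exists_preimage ht x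
      obtain ⟨-, h4, -, h5⟩ := h.transported hinv hc ht ξ (hct _ (norm_nonneg _)) (hcρ ‖ξ‖)
      exact norm_fderiv_radialField_le hx h4 (hc' _) h5 (h₃ _ (norm_nonneg _))
  have h4 : (⨆ x, ‖W x‖ₑ) ≤ ENNReal.ofReal M := iSup_le fun x => by
    rw [← ofReal_norm]; exact ENNReal.ofReal_le_ofReal (hval x)
  have h5 : (⨆ x, ‖fderiv ℝ W x‖ₑ) ≤ ENNReal.ofReal (3 * M) := iSup_le fun x => by
    rw [← ofReal_norm]; exact ENNReal.ofReal_le_ofReal (hder x)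
  calc c1Norm W ≤ ENNReal.ofReal M + ENNReal.ofReal (3 * M) := add_le_add h4 h5
    _ = ENNReal.ofReal (4 * M) := by
      rw [← ENNReal.ofReal_add hM (by linarith)]; congr 1; ring

/-- Positivity of the density bounds both the radial density and its mean. -/
theorem density_bounds {d : ℕ} (hd : 1 ≤ d) {G : ℝ → ℝ} (hG : ContDiff ℝ 1 G) {c : ℝ}
    (h : ∀ x, c < 1 - divergence (radialField d G) x) :
    (∀ ρ, 0 ≤ ρ → c < 1 - d * G ρ) ∧ ∀ ρ, 0 ≤ ρ → c < 1 - d * G ρ - ρ * deriv G ρ := by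
  obtain ⟨e, he⟩ := exists_unit_vector hd
  have h1 (ρ : ℝ) (hρ : 0 ≤ ρ) : c < 1 - d * G ρ - ρ * deriv G ρ := by
    have := h (ρ • e)
    rw [divergence_radialField hG, norm_smul, he, mul_one, Real.norm_of_nonneg hρ] at this
    linarith
  refine ⟨fun ρ hρ => ?_, h1⟩
  have := mean_pos_of_pos (k := 1 - c) hd hG (fun ρ hρ => by linarith [h1 ρ hρ]) ρ hρ
  linarith

theorem radialField_congr {d : ℕ} {f g : ℝ → ℝ} (h : ∀ r, 0 ≤ r → f r = g r) :
    radialField d f = radialField d g :=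
  funext fun x => by rw [radialField, radialField, h _ (norm_nonneg x)]

end ColdPlasma

open ColdPlasma in
theorem theorem3 (d : ℕ) (hd : 1 ≤ d) (F₀ G₀ : ℝ → ℝ)
    (hF₀ : ContDiffOn ℝ 2 F₀ (Ici 0)) (hG₀ : ContDiffOn ℝ 2 G₀ (Ici 0))
    (hV₀ : ColdPlasma.c1Norm (ColdPlasma.radialField d F₀) < ⊤)
    (hE₀ : ColdPlasma.c1Norm (ColdPlasma.radialField d G₀) < ⊤)
    (hn₀ : ∀ x, 0 < 1 - ColdPlasma.divergence (ColdPlasma.radialField d G₀) x) :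
    ∃ ν : ℝ, 2 < ν ∧ ∃ V E : ℝ → ColdPlasma.Space d → ColdPlasma.Space d,
      ColdPlasma.IsRadialSolution d ν F₀ G₀ (Ici 0) V E ∧
      (∀ (T : ℝ) (V' E' : ℝ → ColdPlasma.Space d → ColdPlasma.Space d),
        ColdPlasma.IsRadialSolution d ν F₀ G₀ (Ico 0 T) V' E' →
          ∀ t ∈ Ico 0 T, V' t = V t ∧ E' t = E t) ∧
      ((∃ c : ℝ, 0 < c ∧
          ∀ x, c ≤ 1 - ColdPlasma.divergence (ColdPlasma.radialField d G₀) x) →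
        (∃ C : ℝ, 0 < C ∧ ∀ t : ℝ, 0 ≤ t →
          ColdPlasma.c1Norm (V t) + ColdPlasma.c1Norm (E t) ≤
            ENNReal.ofReal (C * Real.exp (-((ν - Real.sqrt (ν ^ 2 - 4)) / 2 * t)))) ∧
        Tendsto (fun t : ℝ => ColdPlasma.c1Norm (V t) + ColdPlasma.c1Norm (E t))
          atTop (𝓝 0)) := by
  obtain ⟨f, hf, hfF⟩ := exists_contDiff_extension hF₀
  obtain ⟨g, hg, hgG⟩ := exists_contDiff_extension hG₀
  rw [← radialField_congr hfF] at hV₀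
  rw [← radialField_congr hgG] at hE₀ hn₀ ⊢
  obtain ⟨B₁, hB₁, hfB⟩ := exists_bound_of_c1Norm_lt_top hd hf hV₀
  obtain ⟨B₂, hB₂, hgB⟩ := exists_bound_of_c1Norm_lt_top hd hg hE₀
  obtain ⟨hN, hn⟩ := density_bounds hd hg hn₀
  have hd1 : (1 : ℝ) ≤ d := by exact_mod_cast hd
  set B := B₁ + B₂ with hB
  have hB0 : 0 ≤ B := by positivity
  have hB₁' : B₁ ≤ B := by linarith
  have hB₂' : B₂ ≤ B := by linarith
  set A := 1 + (d : ℝ) * B with hA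
  have hA1 : 1 ≤ A := by rw [hA]; nlinarith
  have hNA (ρ : ℝ) (hρ : 0 ≤ ρ) : 1 - d * g ρ ≤ A := by
    have h1 := (neg_abs_le (g ρ)).trans' (neg_le_neg ((hgB ρ hρ).1.trans hB₂'))
    have h2 := mul_le_mul_of_nonneg_left h1 (zero_le_one.trans hd1)
    linarith
  -- The first summand serves the barriers for `F` and `N`, the second the Jacobian condition `8 (2A
  -- + 1) < ν²`.
  set ν := 8 * (d : ℝ) * (B + 1) + 8 * (2 * A + 1) with hν
  have hdB : 0 ≤ 8 * (d : ℝ) * (B + 1) := by positivity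
  have hν2 : 2 < ν := by linarith
  obtain ⟨F, G, l, Fρ, Gρ, lρ, h⟩ := exists_charFamily (ν := ν) hd1 hA1 hB0
    (by linarith) (by nlinarith) hf hg (fun ρ hρ => (hfB ρ hρ).1.trans hB₁')
    (fun ρ hρ => (hfB ρ hρ).2.2.trans hB₁') hN hNA hn
  obtain ⟨inv, hinv⟩ := h.exists_inverse
  refine ⟨ν, hν2, _, _, h.isRadialSolution hinv hfF hgG,
    fun T V' E' h' t ht => h.eq_of_isRadialSolution hinv hfF hgG h' ht, ?_⟩
  rintro ⟨c, hc, hcn⟩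
  -- Halving `c` gives the strict inequality needed to pass to the mean density.
  obtain ⟨hcN, hcn⟩ := density_bounds hd hg (c := c / 2) fun x => by linarith [hcn x]
  have hs4 : 0 < ν ^ 2 - 4 := by nlinarith
  have hs := Real.sq_sqrt hs4.le
  have hs0 := Real.sqrt_pos.2 hs4
  have ha : 0 < (ν - Real.sqrt (ν ^ 2 - 4)) / 2 := by
    have : Real.sqrt (ν ^ 2 - 4) < ν := (Real.sqrt_lt' (by linarith)).2 (by linarith)
    linarith
  -- Here `a` and `b` are the roots of `λ² - νλ + 1`, distinct because `ν > 2`.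
  obtain ⟨C, hC, hdec⟩ := h.exists_decay (b := (ν + Real.sqrt (ν ^ 2 - 4)) / 2) hd1 hA1 hB0
    (half_pos hc) ha (by linarith) (by linear_combination -hs / 4) (by ring)
    (fun ρ hρ => (hfB ρ hρ).1.trans hB₁') (fun ρ hρ => (hgB ρ hρ).1.trans hB₂')
    (fun ρ hρ => (hfB ρ hρ).2.1.trans hB₁') (fun ρ hρ => (hgB ρ hρ).2.1.trans hB₂')
    (fun ρ hρ => (hfB ρ hρ).2.2.trans hB₁') (fun ρ hρ => (hgB ρ hρ).2.2.trans hB₂')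
    (fun ρ hρ => (hcN ρ hρ).le) hNA (fun ρ hρ => (hcn ρ hρ).le)
  set a := (ν - Real.sqrt (ν ^ 2 - 4)) / 2
  have hbound (t : ℝ) (ht : 0 ≤ t) :
      c1Norm (radialField d (fun r => F t (inv t r))) +
        c1Norm (radialField d (fun r => G t (inv t r))) ≤
      ENNReal.ofReal (8 * C * Real.exp (-(a * t))) := by
    have h1 := h.c1Norm_transported_le hinv h.contDiff_F ht
      (fun ρ hρ => h.hasDerivAt_F t ρ ht hρ) (h.hasDerivAt_F_snd t)
      (fun ρ hρ => (hdec t ρ ht hρ).1) (fun ρ hρ => (hdec t ρ ht hρ).2.2.1)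
      (fun ρ hρ => (hdec t ρ ht hρ).2.2.2.2.1)
    have h2 := h.c1Norm_transported_le hinv h.contDiff_G ht
      (fun ρ hρ => h.hasDerivAt_G t ρ ht hρ) (h.hasDerivAt_G_snd t)
      (fun ρ hρ => (hdec t ρ ht hρ).2.1) (fun ρ hρ => (hdec t ρ ht hρ).2.2.2.1)
      (fun ρ hρ => (hdec t ρ ht hρ).2.2.2.2.2)
    refine (add_le_add h1 h2).trans ?_
    rw [← ENNReal.ofReal_add (by positivity) (by positivity)]
    exact ENNReal.ofReal_le_ofReal (by linarith)
  refine ⟨⟨8 * C, by positivity, hbound⟩, ?_⟩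
  have hlim : Tendsto (fun t : ℝ => ENNReal.ofReal (8 * C * Real.exp (-(a * t)))) atTop (𝓝 0) := by
    have h1 : Tendsto (fun t : ℝ => 8 * C * Real.exp (-(a * t))) atTop (𝓝 (8 * C * 0)) :=
      (Real.tendsto_exp_neg_atTop_nhds_zero.comp
        (tendsto_id.const_mul_atTop ha)).const_mul (8 * C)
    simpa using ENNReal.tendsto_ofReal h1
  exact tendsto_of_tendsto_of_tendsto_of_le_of_le' tendsto_const_nhds hlim
    (Eventually.of_forall fun _ => zero_le) ((eventually_ge_atTop 0).mono hbound)
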